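/- Notation. For real $\mu\ge 0$ let $H^\mu$ be the space of real functions $f\in L^2(0,1)$, extended with period $1$, with $\|f\|_\mu=\big(\sum_{k\in\mathbb Z}(1+k^2)^\mu|\widehat f(k)|^2\big)^{1/2}<\infty$, where $\widehat f(k)=\int_0^1 f(x)e^{-2\pi i kx}\,dx$. Let $\|\cdot\|$ and $(f,g)=\int_0^1 f\,\overline g\,dx$ be the norm and inner product of $L^2(0,1)$. For an integer $N\ge 1$ let $S_N=\mathrm{span}\{e^{2\pi i kx}: k\in\mathbb Z,\ -N\le k\le N\}$, and let $Pv=\sum_{|k|\le N}\widehat v(k)e^{2\pi i kx}$ be the $L^2$-projection onto $S_N$. Let $\kappa_1,\kappa_2>0$, $\lambda\in\mathbb R$ (for internal waves with density ratio $\gamma$ and depth ratio $\delta$: $\kappa_1=\frac1{\delta+\gamma}$, $\kappa_2=1-\gamma$, $\lambda=\frac{\delta^2-\gamma}{(\delta+\gamma)^2}$), let $b,d>0$, $T>0$ and let $\mu\ge 1$ be real. Suppose that $\zeta,u\in C^1([0,T];H^\mu)$ solve the $1$-periodic initial-value problem of BBM–BBM type (the Boussinesq/Boussinesq system with $b,d>0$,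 $a=c=0$) $$\zeta_t+\kappa_1u_x+\lambda(\zeta u)_x-b\zeta_{xxt}=0,\qquad u_t+\kappa_2\zeta_x+\lambda uu_x-d\,u_{xxt}=0,\qquad 0\le t\le T,$$ $$\zeta(\cdot,0)=\zeta_0,\quad u(\cdot,0)=u_0,$$ where for each $t$ the $x$-derivatives are taken in the sense of periodic distributions and $uu_x=\frac12(u^2)_x$. Then there are a constant $C>0$ and an integer $N_0\ge 1$ such that for every integer $N\ge N_0$ there exist unique real-valued $\zeta_N,u_N:[0,T]\to S_N$, differentiable in $t$, that satisfy, for all $0\le t\le T$ and all $\varphi,\chi\in S_N$, $$(\zeta_{Nt},\varphi)+\kappa_1(u_{Nx},\varphi)+\lambda((\zeta_Nu_N)_x,\varphi)-b(\zeta_{Nxxt},\varphi)=0,$$ $$(u_{Nt},\chi)+\kappa_2(\zeta_{Nx},\chi)+\lambda(u_Nu_{Nx},\chi)-d(u_{Nxxt},\chi)=0,$$ with $\zeta_N(0)=P\zeta_0$, $u_N(0)=Pu_0$, and they satisfy $$\max_{0\le t\le T}\big(\|\zeta_N(t)-\zeta(t)\|+\|u_N(t)-u(t)\|\big)\le C\,N^{-\mu}.$$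 The constants $C$ and $N_0$ do not depend on $N$ (they may depend on $\kappa_1,\kappa_2,\lambda,b,d,T,\mu,\zeta,u$). -/

import Mathlib

open MeasureTheory Set
open scoped ContDiff ComplexConjugate

noncomputable section

namespace BBM

/-! ### Periodic Sobolev spaces of real functions of period one -/

/-- Real-valued square integrable functions of period one. The measure `haarAddCircle` on
`ℝ / ℤ` is Lebesgue measure on a period. -/
abbrev L2per : Type := Lp ℝ 2 (AddCircle.haarAddCircle (T := (1 : ℝ)))

/-- The `k`-th Fourier coefficient `∫₀¹ f(x) exp(-2πikx) dx`. -/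
def fc (f : L2per) (k : ℤ) : ℂ :=
  fourierCoeff (T := (1 : ℝ)) (fun x => ((f x : ℝ) : ℂ)) k

/-- An element of `L2per` regarded as a (complexified) element of complex `L²`. -/
theorem memLp_ofReal (f : L2per) :
    MemLp (fun x => ((f x : ℝ) : ℂ)) 2 (AddCircle.haarAddCircle (T := (1 : ℝ))) :=
  (Lp.memLp f).ofReal

theorem integrable_ofReal (f : L2per) :
    Integrable (fun x => ((f x : ℝ) : ℂ)) (AddCircle.haarAddCircle (T := (1 : ℝ))) :=
  (memLp_ofReal f).integrable (by norm_num)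

theorem fc_add (f g : L2per) (k : ℤ) : fc (f + g) k = fc f k + fc g k := by
  have h : (fun x => (((f + g : L2per) x : ℝ) : ℂ)) =ᵐ[AddCircle.haarAddCircle (T := (1 : ℝ))]
      (fun x => ((f x : ℝ) : ℂ)) + (fun x => ((g x : ℝ) : ℂ)) := by
    filter_upwards [Lp.coeFn_add f g] with x hx
    rw [hx]
    simp only [Pi.add_apply, Complex.ofReal_add]
  unfold fc
  rw [fourierCoeff_congr_ae h, fourierCoeff.add (integrable_ofReal f) (integrable_ofReal g)]
  rfl

theorem fc_smul (c : ℝ) (f : L2per) (k : ℤ) : fc (c • f) k = c • fc f k := by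
  have h : (fun x => (((c • f : L2per) x : ℝ) : ℂ)) =ᵐ[AddCircle.haarAddCircle (T := (1 : ℝ))]
      (fun x => (c : ℂ) * ((f x : ℝ) : ℂ)) := by
    filter_upwards [Lp.coeFn_smul c f] with x hx
    simp [hx]
  unfold fc
  rw [fourierCoeff_congr_ae h, fourierCoeff.const_mul]
  simp

theorem eq_zero_of_fc (f : L2per) (h : ∀ k, fc f k = 0) : f = 0 := by
  set F : Lp ℂ 2 (AddCircle.haarAddCircle (T := (1 : ℝ))) := (memLp_ofReal f).toLp _ with hF
  have hae := (memLp_ofReal f).coeFn_toLp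
  have h0 : F = 0 := by
    apply (fourierBasis (T := (1 : ℝ))).repr.injective
    ext k
    rw [fourierBasis_repr, fourierCoeff_congr_ae hae]
    simpa [fc] using h k
  rw [Lp.eq_zero_iff_ae_eq_zero]
  have h1 := Lp.coeFn_zero ℂ 2 (AddCircle.haarAddCircle (T := (1 : ℝ)))
  rw [← h0] at h1
  filter_upwards [hae, h1] with x hx hx'
  rw [hx] at hx'
  simpa using hx'

/-- The weight `(1 + k²)^{μ/2}`. -/
def weight (μ : ℝ) (k : ℤ) : ℝ := (1 + (k : ℝ) ^ 2) ^ (μ / 2)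

theorem weight_pos (μ : ℝ) (k : ℤ) : 0 < weight μ k := by
  unfold weight; positivity

theorem weight_sq (μ : ℝ) (k : ℤ) (z : ℂ) :
    ‖weight μ k • z‖ ^ 2 = (1 + (k : ℝ) ^ 2) ^ μ * ‖z‖ ^ 2 := by
  have h0 : (0 : ℝ) ≤ 1 + (k : ℝ) ^ 2 := by positivity
  rw [norm_smul, mul_pow, Real.norm_of_nonneg (weight_pos μ k).le]
  congr 1
  rw [weight, ← Real.rpow_natCast, ← Real.rpow_mul h0]
  norm_num

theorem memlp_iff (μ : ℝ) (f : L2per) :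
    Memℓp (fun k : ℤ => weight μ k • fc f k) 2 ↔
      Summable (fun k : ℤ => (1 + (k : ℝ) ^ 2) ^ μ * ‖fc f k‖ ^ 2) := by
  rw [memℓp_gen_iff (by norm_num)]
  refine summable_congr fun k => ?_
  rw [← weight_sq]
  norm_num

/-- Those `f` in `L²` with `∑ (1 + k²)^μ |f̂(k)|² < ∞` (used for `μ ≥ 0`). -/
def sobolevSubmodule (μ : ℝ) : Submodule ℝ L2per where
  carrier := {f | Summable (fun k : ℤ => (1 + (k : ℝ) ^ 2) ^ μ * ‖fc f k‖ ^ 2)}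
  add_mem' := by
    intro f g hf hg
    rw [mem_ofPred_eq, ← memlp_iff] at *
    convert hf.add hg using 1
    ext k
    rw [fc_add, smul_add]
    rfl
  zero_mem' := by
    rw [mem_ofPred_eq, ← memlp_iff]
    convert (zero_memℓp : Memℓp (0 : ℤ → ℂ) 2) using 1
    ext k
    have h := fc_smul 0 0 k
    rw [zero_smul, zero_smul] at h
    simp [h]
  smul_mem' := by
    intro c f hf
    rw [mem_ofPred_eq, ← memlp_iff] at *
    convert hf.const_smul c using 1
    ext k
    simp [fc_smul, mul_left_comm]

/-- The periodic Sobolev space `H^μ` of real functions of period one. It is a type of its own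
because it carries the `H^μ` norm and not the `L²` norm. -/
def HPer (μ : ℝ) : Type := ↥(sobolevSubmodule μ)

instance (μ : ℝ) : AddCommGroup (HPer μ) := inferInstanceAs (AddCommGroup ↥(sobolevSubmodule μ))

instance (μ : ℝ) : Module ℝ (HPer μ) := inferInstanceAs (Module ℝ ↥(sobolevSubmodule μ))

/-- The inclusion of `H^μ` in `L²`. -/
def HPer.toL2 {μ : ℝ} : HPer μ →ₗ[ℝ] L2per := (sobolevSubmodule μ).subtype

/-- The weighted Fourier coefficients `(1 + k²)^{μ/2} f̂(k)`, as an element of `ℓ²(ℤ)`. -/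
def HPer.weighted (μ : ℝ) : HPer μ →ₗ[ℝ] lp (fun _ : ℤ => ℂ) 2 where
  toFun f := ⟨fun k => weight μ k • fc f.toL2 k, (memlp_iff μ f.toL2).2 f.2⟩
  map_add' f g := by
    ext k
    change weight μ k • fc (f + g).toL2 k = weight μ k • fc f.toL2 k + weight μ k • fc g.toL2 k
    rw [map_add, fc_add, smul_add]
  map_smul' c f := by
    ext k
    simp [fc_smul, mul_left_comm]

theorem HPer.weighted_injective (μ : ℝ) : Function.Injective (HPer.weighted μ) := by
  rw [← LinearMap.ker_eq_bot, LinearMap.ker_eq_bot']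
  intro f hf
  apply Subtype.ext
  apply eq_zero_of_fc
  intro k
  have h : (HPer.weighted μ f) k = 0 := by rw [hf]; rfl
  change weight μ k • fc f.toL2 k = 0 at h
  exact (smul_eq_zero.1 h).resolve_left (weight_pos μ k).ne'

/-- The `H^μ` norm; see `HPer.norm_eq`. -/
instance (μ : ℝ) : NormedAddCommGroup (HPer μ) :=
  NormedAddCommGroup.induced (HPer μ) (lp (fun _ : ℤ => ℂ) 2) (HPer.weighted μ)
    (HPer.weighted_injective μ)

instance (μ : ℝ) : NormedSpace ℝ (HPer μ) :=
  NormedSpace.induced ℝ (HPer μ) (lp (fun _ : ℤ => ℂ) 2) (HPer.weighted μ)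

/-- `‖f‖_μ = (∑ (1 + k²)^μ |f̂(k)|²)^{1/2}`. -/
theorem HPer.norm_eq {μ : ℝ} (f : HPer μ) :
    ‖f‖ = Real.sqrt (∑' k : ℤ, (1 + (k : ℝ) ^ 2) ^ μ * ‖fc f.toL2 k‖ ^ 2) := by
  change ‖HPer.weighted μ f‖ = _
  rw [lp.norm_eq_tsum_rpow (by norm_num), Real.sqrt_eq_rpow]
  have h : ∀ k : ℤ, ‖(HPer.weighted μ f) k‖ ^ (2 : ENNReal).toReal
      = (1 + (k : ℝ) ^ 2) ^ μ * ‖fc f.toL2 k‖ ^ 2 := by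
    intro k
    rw [← weight_sq]
    simp [HPer.weighted]
  simp_rw [h]
  norm_num

/-- An element of `H^μ` as a function of period one on the line. -/
def HPer.fn {μ : ℝ} (f : HPer μ) : ℝ → ℝ := fun x => f.toL2 (x : AddCircle (1 : ℝ))

/-! ### The periodic initial-value problem -/

/-- The inner product `∫₀¹ f(x) conj(φ(x)) dx` of a real function `f` and a complex function. -/
def ip (f : ℝ → ℝ) (φ : ℝ → ℂ) : ℂ := ∫ x in (0 : ℝ)..1, (f x : ℂ) * conj (φ x)

/-- The `L²(0,1)` norm. -/
def l2norm (f : ℝ → ℝ) : ℝ := Real.sqrt (∫ x in (0 : ℝ)..1, f x ^ 2)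

/-- `ζ, u ∈ C¹([0,T]; H^μ)` solve
`ζ_t + κ₁ u_x + λ (ζ u)_x + a u_xxx - b ζ_xxt = 0`,
`u_t + κ₂ ζ_x + λ u u_x + c ζ_xxx - d u_xxt = 0`
with `ζ(0) = ζ₀`, `u(0) = u₀`. For each `t ∈ [0,T]` the `x`-derivatives are taken in the sense of
periodic distributions, with `u u_x = (u²/2)_x`. -/
structure IsSolution (κ₁ κ₂ lam a b c d T : ℝ) {μ : ℝ} (ζ₀ u₀ : HPer μ) (ζ u : ℝ → HPer μ) :
    Prop where
  contDiff_ζ : ContDiffOn ℝ 1 ζ (Icc 0 T)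
  contDiff_u : ContDiffOn ℝ 1 u (Icc 0 T)
  init_ζ : ζ 0 = ζ₀
  init_u : u 0 = u₀
  eq_ζ : ∀ t ∈ Icc 0 T, ∀ φ : ℝ → ℂ, ContDiff ℝ ∞ φ → Function.Periodic φ 1 →
    ip (derivWithin ζ (Icc 0 T) t).fn φ
      - κ₁ * ip (u t).fn (deriv φ)
      - lam * ip (fun x => (ζ t).fn x * (u t).fn x) (deriv φ)
      - a * ip (u t).fn (iteratedDeriv 3 φ)
      - b * ip (derivWithin ζ (Icc 0 T) t).fn (iteratedDeriv 2 φ) = 0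
  eq_u : ∀ t ∈ Icc 0 T, ∀ φ : ℝ → ℂ, ContDiff ℝ ∞ φ → Function.Periodic φ 1 →
    ip (derivWithin u (Icc 0 T) t).fn φ
      - κ₂ * ip (ζ t).fn (deriv φ)
      - lam / 2 * ip (fun x => (u t).fn x ^ 2) (deriv φ)
      - c * ip (ζ t).fn (iteratedDeriv 3 φ)
      - d * ip (derivWithin u (Icc 0 T) t).fn (iteratedDeriv 2 φ) = 0

/-! ### The spectral Fourier-Galerkin semidiscretization -/

/-- The exponential `x ↦ exp(2πikx)`. -/
def expo (k : ℤ) : ℝ → ℂ := fun x => Complex.exp (2 * Real.pi * Complex.I * k * x)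

/-- `S_N`, the span of the exponentials with `-N ≤ k ≤ N`. -/
def trigSpace (N : ℕ) : Submodule ℂ (ℝ → ℂ) :=
  Submodule.span ℂ (expo '' {k : ℤ | -(N : ℤ) ≤ k ∧ k ≤ N})

/-- The `L²` projection `P v = ∑_{|k| ≤ N} v̂(k) exp(2πikx)` on `S_N`. -/
def proj (N : ℕ) (v : L2per) : ℝ → ℂ :=
  fun x => ∑ k ∈ Finset.Icc (-(N : ℤ)) N, fc v k * expo k x

/-- The time derivative on `[0,T]` (one-sided at the end points) of a function of `(t, x)`. -/
def timeDeriv (T : ℝ) (v : ℝ → ℝ → ℝ) (t : ℝ) : ℝ → ℝ :=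
  fun x => derivWithin (fun s => v s x) (Icc 0 T) t

/-- The real-valued functions `ζN, uN : [0,T] → S_N` (arguments `t`, `x`) are differentiable in
time and solve the Galerkin equations with the initial values `P ζ₀`, `P u₀`. -/
structure IsSemidiscreteSolution (κ₁ κ₂ lam a b c d T : ℝ) (N : ℕ) (ζ₀ u₀ : L2per)
    (ζN uN : ℝ → ℝ → ℝ) : Prop where
  mem_ζ : ∀ t ∈ Icc 0 T, (fun x => (ζN t x : ℂ)) ∈ trigSpace N
  mem_u : ∀ t ∈ Icc 0 T, (fun x => (uN t x : ℂ)) ∈ trigSpace N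
  diff_ζ : ∀ x, DifferentiableOn ℝ (fun t => ζN t x) (Icc 0 T)
  diff_u : ∀ x, DifferentiableOn ℝ (fun t => uN t x) (Icc 0 T)
  init_ζ : ∀ x, (ζN 0 x : ℂ) = proj N ζ₀ x
  init_u : ∀ x, (uN 0 x : ℂ) = proj N u₀ x
  eq_ζ : ∀ t ∈ Icc 0 T, ∀ φ ∈ trigSpace N,
    ip (timeDeriv T ζN t) φ
      + κ₁ * ip (deriv (uN t)) φ
      + lam * ip (deriv (fun x => ζN t x * uN t x)) φ
      + a * ip (iteratedDeriv 3 (uN t)) φ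
      - b * ip (iteratedDeriv 2 (timeDeriv T ζN t)) φ = 0
  eq_u : ∀ t ∈ Icc 0 T, ∀ χ ∈ trigSpace N,
    ip (timeDeriv T uN t) χ
      + κ₂ * ip (deriv (ζN t)) χ
      + lam * ip (fun x => uN t x * deriv (uN t) x) χ
      + c * ip (iteratedDeriv 3 (ζN t)) χ
      - d * ip (iteratedDeriv 2 (timeDeriv T uN t)) χ = 0

end BBM

end

noncomputable section

namespace BBM

/-! ### Fourier coefficients of real functions -/

local notation "haar" => AddCircle.haarAddCircle (T := (1 : ℝ))

/-! Inverting `1 - b∂²` and `1 - d∂²` turns the system into an ordinary differential equation for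
the pair `(ζ, u)`, with right-hand sides `-(1 - b∂²)⁻¹∂(κ₁u + λζu)` and `-(1 - d∂²)⁻¹∂(κ₂ζ +
(λ/2)u²)`. The symbols of these operators are `O(1/|k|)`, hence in `ℓ²(ℤ)`. The product of two `L²`
functions is integrable, so its Fourier coefficients are bounded by `‖g‖‖h‖`; a bounded sequence
times an `ℓ²` symbol is in `ℓ²`. The right-hand side therefore maps `L² × L²` to itself and is
Lipschitz on balls, and so is its truncation to `|k| ≤ N`, with a constant independent of `N`
(`galerkinField_lipschitzOn`). No inverse inequality is used.

The Galerkin system is `W' = F_N(W)` with `F_N` the truncated field. The exact pair `V` satisfies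
`F_N(V) = PV'`, so it solves this equation up to the residual `V' - PV'`. Since `V` and `V'` are
bounded in `H^μ`, this residual and the initial error `V(0) - PV(0)` are both `O(N^{-μ})` in `L²`
(`norm_sub_projL2_le`), and Grönwall's inequality gives the estimate. Existence on all of `[0,T]`
comes from the same bound: `F_N` is cut off outside a ball, and for large `N` the solution of the
modified equation stays so close to `V` that the cutoff is never active (`exists_solution_near`).

It remains to identify curves in `L²` with functions of `(t, x)` solving the variational equations.
A curve starting in `S_N` stays there because `F_N` takes values in `S_N`. Conversely, every
semidiscrete solution gives a curve through its discrete Fourier coefficients, and uniqueness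
follows from uniqueness for the differential equation. -/

theorem norm_toLp_ofReal (f : L2per) : ‖(memLp_ofReal f).toLp _‖ = ‖f‖ := by
  rw [Lp.norm_toLp, Lp.norm_def]
  congr 1
  refine eLpNorm_congr_norm_ae ?_
  filter_upwards with x
  simp

theorem hasSum_sq_norm_fc (f : L2per) : HasSum (fun k => ‖fc f k‖ ^ 2) (‖f‖ ^ 2) := by
  set F : Lp ℂ 2 haar := (memLp_ofReal f).toLp _ with hF
  have hae := (memLp_ofReal f).coeFn_toLp
  have h := hasSum_sq_fourierCoeff F
  have h2 : ∫ t, ‖F t‖ ^ 2 ∂haar = ‖f‖ ^ 2 := by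
    have H₃ := congr_arg RCLike.re (@L2.inner_def (AddCircle (1 : ℝ)) ℂ ℂ _ _ _ _ _ F F)
    rw [← integral_re] at H₃
    · rw [← norm_toLp_ofReal f, ← hF, ← inner_self_eq_norm_sq (𝕜 := ℂ) F, H₃]
      refine integral_congr_ae (Filter.Eventually.of_forall fun x => ?_)
      simp only [inner_self_eq_norm_sq]
    · exact L2.integrable_inner F F
  rw [h2, fourierCoeff_congr_ae hae] at h
  exact h

theorem norm_fc_le (f : L2per) (k : ℤ) : ‖fc f k‖ ≤ ‖f‖ := by
  have h := hasSum_sq_norm_fc f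
  have h1 := le_hasSum h k fun j _ => by positivity
  exact (sq_le_sq₀ (norm_nonneg _) (norm_nonneg _)).1 h1

theorem fc_ext {f g : L2per} (h : ∀ k, fc f k = fc g k) : f = g := by
  rw [← sub_eq_zero]
  refine eq_zero_of_fc _ fun k => ?_
  rw [sub_eq_add_neg, ← neg_one_smul ℝ g, fc_add, fc_smul, h]
  simp

/-- The `k`-th Fourier coefficient as a continuous linear functional. -/
def fcL (k : ℤ) : L2per →L[ℝ] ℂ :=
  LinearMap.mkContinuous
    { toFun := fun f => fc f k
      map_add' := fun f g => fc_add f g k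
      map_smul' := fun c f => fc_smul c f k } 1 fun f => by
        simpa using norm_fc_le f k

theorem fc_sub (f g : L2per) (k : ℤ) : fc (f - g) k = fc f k - fc g k := map_sub (fcL k) f g

/-- Sequences that can be the Fourier coefficients of a real function. -/
def IsHermitian (c : ℤ → ℂ) : Prop := ∀ k, c (-k) = conj (c k)

theorem fourierCoeff_ofReal_isHermitian (f : AddCircle (1 : ℝ) → ℝ) :
    IsHermitian (fourierCoeff (fun x => (f x : ℂ))) := by
  intro k
  unfold fourierCoeff
  rw [← integral_conj]
  congr 1
  ext x
  rw [fourier_neg]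
  simp

theorem fc_isHermitian (f : L2per) : IsHermitian (fc f) :=
  fourierCoeff_ofReal_isHermitian _

/-! ### Fourier coefficients of products -/

/-- The `k`-th Fourier coefficient of the product of two square integrable functions. -/
def pc (f g : L2per) (k : ℤ) : ℂ :=
  fourierCoeff (T := (1 : ℝ)) (fun x => ((f x * g x : ℝ) : ℂ)) k

theorem pc_isHermitian (f g : L2per) : IsHermitian (pc f g) :=
  fourierCoeff_ofReal_isHermitian _

theorem integrable_mul_L2 (f g : L2per) : Integrable (fun x => f x * g x) haar :=
  (Lp.memLp f).integrable_mul (Lp.memLp g)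

/-- Cauchy–Schwarz gives a bound uniform in `k`, with no decay. The summability needed to return to
`L²` is supplied later by the symbol. -/
theorem norm_pc_le (f g : L2per) (k : ℤ) : ‖pc f g k‖ ≤ ‖f‖ * ‖g‖ := by
  have h1 : ‖pc f g k‖ ≤ ∫ x, |f x| * |g x| ∂haar := by
    unfold pc fourierCoeff
    refine (norm_integral_le_integral_norm _).trans (le_of_eq ?_)
    refine integral_congr_ae (Filter.Eventually.of_forall fun x => ?_)
    have h0 : ‖fourier (-k) x‖ = 1 := Circle.norm_coe _
    simp only [norm_smul, h0, one_mul]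
    simp
  have h2 : ∫ x, |f x| * |g x| ∂haar = inner ℝ |f| |g| := by
    rw [L2.inner_def]
    refine integral_congr_ae ?_
    filter_upwards [Lp.coeFn_abs f, Lp.coeFn_abs g] with x hf hg
    simp [hf, hg, mul_comm]
  calc ‖pc f g k‖ ≤ inner ℝ |f| |g| := h2 ▸ h1
    _ ≤ ‖|f|‖ * ‖|g|‖ := real_inner_le_norm _ _
    _ = ‖f‖ * ‖g‖ := by rw [norm_abs_eq_norm, norm_abs_eq_norm]

theorem pc_add_left (f f' g : L2per) (k : ℤ) : pc (f + f') g k = pc f g k + pc f' g k := by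
  have h : (fun x => (((f + f' : L2per) x * g x : ℝ) : ℂ)) =ᵐ[haar]
      (fun x => ((f x * g x : ℝ) : ℂ)) + (fun x => ((f' x * g x : ℝ) : ℂ)) := by
    filter_upwards [Lp.coeFn_add f f'] with x hx
    rw [hx]
    simp only [Pi.add_apply]
    push_cast
    ring
  unfold pc
  rw [fourierCoeff_congr_ae h, fourierCoeff.add (integrable_mul_L2 f g).ofReal
    (integrable_mul_L2 f' g).ofReal]
  rfl

theorem pc_comm (f g : L2per) (k : ℤ) : pc f g k = pc g f k := by
  simp only [pc, mul_comm]

theorem pc_sub_left (f f' g : L2per) (k : ℤ) : pc (f - f') g k = pc f g k - pc f' g k := by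
  rw [eq_sub_iff_add_eq, ← pc_add_left, sub_add_cancel]

theorem norm_pc_sub_le (f g f' g' : L2per) (k : ℤ) :
    ‖pc f g k - pc f' g' k‖ ≤ ‖f - f'‖ * ‖g‖ + ‖f'‖ * ‖g - g'‖ := by
  have h : pc f g k - pc f' g' k = pc (f - f') g k + pc f' (g - g') k := by
    rw [pc_comm f' (g - g'), pc_sub_left, pc_sub_left, pc_comm g f', pc_comm g' f']
    ring
  rw [h]
  exact (norm_add_le _ _).trans (add_le_add (norm_pc_le _ _ _) (norm_pc_le _ _ _))

/-! ### Real trigonometric polynomials -/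

/-- The frequencies `-N, …, N`. -/
abbrev band (N : ℕ) : Finset ℤ := Finset.Icc (-(N : ℤ)) N

/-- The real part of `∑_{|k| ≤ N} c_k exp(2πikx)`. -/
def synth (N : ℕ) (c : ℤ → ℂ) : L2per :=
  Complex.reCLM.compLpL 2 haar (∑ k ∈ band N, c k • fourierLp 2 k)

theorem neg_mem_band {N : ℕ} {k : ℤ} : -k ∈ band N ↔ k ∈ band N := by
  simp only [Finset.mem_Icc]
  omega

theorem coeFn_sum_fourierLp (N : ℕ) (c : ℤ → ℂ) :
    (∑ k ∈ band N, c k • fourierLp (T := (1 : ℝ)) 2 k : Lp ℂ 2 haar) =ᵐ[haar]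
      fun x => ∑ k ∈ band N, c k * fourier k x := by
  have h1 := Lp.coeFn_fun_finsetSum (p := 2) (μ := haar) (band N)
    (fun k => c k • fourierLp (T := (1 : ℝ)) 2 k)
  have h2 : ∀ᵐ x ∂haar, ∀ k : ℤ, (c k • fourierLp (T := (1 : ℝ)) 2 k : Lp ℂ 2 haar) x
      = c k * fourier k x := by
    rw [ae_all_iff]
    intro k
    filter_upwards [Lp.coeFn_smul (c k) (fourierLp (T := (1 : ℝ)) 2 k),
      coeFn_fourierLp (T := (1 : ℝ)) 2 k] with x hx hx'
    rw [hx, Pi.smul_apply, hx', smul_eq_mul]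
  filter_upwards [h1, h2] with x hx hx'
  rw [hx]
  exact Finset.sum_congr rfl fun k _ => hx' k

theorem coeFn_synth (N : ℕ) (c : ℤ → ℂ) :
    synth N c =ᵐ[haar] fun x => (∑ k ∈ band N, c k * fourier k x).re := by
  filter_upwards [Complex.reCLM.coeFn_compLpL (∑ k ∈ band N, c k • fourierLp (T := (1 : ℝ)) 2 k),
    coeFn_sum_fourierLp N c] with x hx hx'
  rw [synth, hx, hx']
  rfl

/-- Conjugation permutes the terms by `k ↦ -k`, and the band is symmetric. -/
theorem IsHermitian.sum_im {c e : ℤ → ℂ} (hc : IsHermitian c) (he : IsHermitian e) (N : ℕ) :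
    (∑ k ∈ band N, c k * e k).im = 0 := by
  rw [← Complex.conj_eq_iff_im, map_sum]
  refine Finset.sum_nbij' (fun k => -k) (fun k => -k) ?_ ?_ ?_ ?_ ?_
  · intro k hk; exact neg_mem_band.2 hk
  · intro k hk; exact neg_mem_band.2 hk
  · intro k _; simp
  · intro k _; simp
  · intro k _
    rw [hc, he, map_mul]

theorem norm_sum_fourierLp_sq (N : ℕ) (c : ℤ → ℂ) :
    ‖(∑ k ∈ band N, c k • fourierLp (T := (1 : ℝ)) 2 k : Lp ℂ 2 haar)‖ ^ 2
      = ∑ k ∈ band N, ‖c k‖ ^ 2 := by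
  have h := (orthonormal_fourier (T := (1 : ℝ))).inner_sum c c (band N)
  have h' := inner_self_eq_norm_sq_to_K (𝕜 := ℂ)
    (∑ k ∈ band N, c k • fourierLp (T := (1 : ℝ)) 2 k : Lp ℂ 2 haar)
  rw [h'] at h
  have h2 : (∑ k ∈ band N, conj (c k) * c k) = ((∑ k ∈ band N, ‖c k‖ ^ 2 : ℝ) : ℂ) := by
    push_cast
    exact Finset.sum_congr rfl fun k _ => Complex.conj_mul' _
  rw [h2] at h
  apply Complex.ofReal_injective
  push_cast at h ⊢
  exact h

theorem norm_synth_sq_le (N : ℕ) (c : ℤ → ℂ) : ‖synth N c‖ ^ 2 ≤ ∑ k ∈ band N, ‖c k‖ ^ 2 := by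
  rw [← norm_sum_fourierLp_sq]
  refine pow_le_pow_left₀ (norm_nonneg _) ?_ 2
  have h := Complex.reCLM.norm_compLp_le
    (∑ k ∈ band N, c k • fourierLp (T := (1 : ℝ)) 2 k : Lp ℂ 2 haar)
  rw [Complex.reCLM_norm, one_mul] at h
  exact h

theorem synth_sub (N : ℕ) (c c' : ℤ → ℂ) :
    synth N (fun k => c k - c' k) = synth N c - synth N c' := by
  simp only [synth, sub_smul, Finset.sum_sub_distrib, map_sub]

theorem synth_congr {N : ℕ} {c c' : ℤ → ℂ} (h : ∀ k ∈ band N, c k = c' k) :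
    synth N c = synth N c' := by
  unfold synth
  rw [Finset.sum_congr rfl fun k hk => by rw [h k hk]]

theorem fourier_isHermitian (x : AddCircle (1 : ℝ)) : IsHermitian (fun k => fourier k x) :=
  fun _ => fourier_neg

/-- For Hermitian coefficients the sum is already real, so the real part taken in `synth` loses
nothing. -/
theorem fc_synth {c : ℤ → ℂ} (hc : IsHermitian c) (N : ℕ) (k : ℤ) :
    fc (synth N c) k = if k ∈ band N then c k else 0 := by
  have h : (fun x => ((synth N c x : ℝ) : ℂ)) =ᵐ[haar]
      (∑ k ∈ band N, c k • fourierLp (T := (1 : ℝ)) 2 k : Lp ℂ 2 haar) := by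
    filter_upwards [coeFn_synth N c, coeFn_sum_fourierLp N c] with x hx hx'
    rw [hx, hx', ← Complex.conj_eq_iff_re, Complex.conj_eq_iff_im]
    exact hc.sum_im (fourier_isHermitian x) N
  unfold fc
  rw [fourierCoeff_congr_ae h, ← fourierBasis_repr, HilbertBasis.repr_apply_apply,
    coe_fourierBasis]
  simp only [inner_sum, inner_smul_right, orthonormal_iff_ite.1 orthonormal_fourier]
  simp

/-- The `L²` projection on the real trigonometric polynomials of degree `N`. -/
def projL2 (N : ℕ) (f : L2per) : L2per := synth N (fc f)

theorem fc_projL2 (N : ℕ) (f : L2per) (k : ℤ) :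
    fc (projL2 N f) k = if k ∈ band N then fc f k else 0 :=
  fc_synth (fc_isHermitian f) N k

theorem norm_synth_le {c : ℤ → ℂ} {M : ℝ} (hM : 0 ≤ M) (N : ℕ)
    (h : ∑ k ∈ band N, ‖c k‖ ^ 2 ≤ M ^ 2) : ‖synth N c‖ ≤ M :=
  (sq_le_sq₀ (norm_nonneg _) hM).1 ((norm_synth_sq_le N c).trans h)

theorem norm_projL2_le (N : ℕ) (f : L2per) : ‖projL2 N f‖ ≤ ‖f‖ :=
  norm_synth_le (norm_nonneg _) N
    (sum_le_hasSum _ (fun _ _ => by positivity) (hasSum_sq_norm_fc f))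

/-- `projL2` as a continuous linear map. -/
def projCLM (N : ℕ) : L2per →L[ℝ] L2per :=
  LinearMap.mkContinuous
    { toFun := projL2 N
      map_add' := fun f g => fc_ext fun k => by
        simp only [fc_add, fc_projL2]; split_ifs <;> simp
      map_smul' := fun c f => fc_ext fun k => by
        simp only [fc_smul, fc_projL2, RingHom.id_apply]; split_ifs <;> simp } 1 fun f => by
        simpa using norm_projL2_le N f

@[simp] theorem projCLM_apply (N : ℕ) (f : L2per) : projCLM N f = projL2 N f := rfl

/-- The error of the `L²` projection of a function in `H^μ`. -/
theorem norm_sub_projL2_le {μ : ℝ} (hμ : 0 ≤ μ) (f : HPer μ) {N : ℕ} (hN : 1 ≤ N) :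
    ‖f.toL2 - projL2 N f.toL2‖ ≤ ‖f‖ * (N : ℝ) ^ (-μ) := by
  have hN' : (0 : ℝ) < N := by exact_mod_cast hN
  refine (sq_le_sq₀ (norm_nonneg _) (by positivity)).1 ?_
  have hs : Summable (fun k : ℤ => (1 + (k : ℝ) ^ 2) ^ μ * ‖fc f.toL2 k‖ ^ 2) := f.2
  have hf : ‖f‖ ^ 2 = ∑' k : ℤ, (1 + (k : ℝ) ^ 2) ^ μ * ‖fc f.toL2 k‖ ^ 2 := by
    rw [HPer.norm_eq, Real.sq_sqrt (tsum_nonneg fun k => by positivity)]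
  rw [mul_pow, hf, ← (hasSum_sq_norm_fc _).tsum_eq, ← tsum_mul_right]
  refine (hasSum_sq_norm_fc _).summable.tsum_le_tsum (fun k => ?_) (hs.mul_right _)
  rw [fc_sub, fc_projL2]
  split_ifs with hk
  · simp only [sub_self, norm_zero, ne_eq, OfNat.ofNat_ne_zero, not_false_eq_true, zero_pow]
    positivity
  · rw [sub_zero]
    have hk2 : (N : ℝ) ^ 2 ≤ 1 + (k : ℝ) ^ 2 := by
      have h1 : (N : ℝ) ≤ |(k : ℝ)| := by
        simp only [Finset.mem_Icc] at hk
        have : (N : ℤ) ≤ |k| := by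
          rcases le_total 0 k with h | h
          · rw [abs_of_nonneg h]; omega
          · rw [abs_of_nonpos h]; omega
        exact_mod_cast this
      have := pow_le_pow_left₀ hN'.le h1 2
      rw [sq_abs] at this
      linarith
    have h3 : ((N : ℝ) ^ 2) ^ μ ≤ (1 + (k : ℝ) ^ 2) ^ μ :=
      Real.rpow_le_rpow (by positivity) hk2 hμ
    -- Outside the band the weight is at least `N^{2μ}`, which the squared factor `N^{-μ}` exactly
    -- compensates.
    have h4 : ((N : ℝ) ^ 2) ^ μ * ((N : ℝ) ^ (-μ)) ^ 2 = 1 := by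
      rw [← Real.rpow_natCast_mul hN'.le, ← Real.rpow_mul_natCast hN'.le, ← Real.rpow_add hN']
      push_cast
      rw [show 2 * μ + -μ * 2 = 0 by ring, Real.rpow_zero]
    calc ‖fc f.toL2 k‖ ^ 2 = ((N : ℝ) ^ 2) ^ μ * ‖fc f.toL2 k‖ ^ 2 * ((N : ℝ) ^ (-μ)) ^ 2 := by
          rw [mul_right_comm, h4, one_mul]
      _ ≤ _ := by gcongr

theorem norm_toL2_le {μ : ℝ} (hμ : 0 ≤ μ) (f : HPer μ) : ‖f.toL2‖ ≤ ‖f‖ := by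
  refine (sq_le_sq₀ (norm_nonneg _) (norm_nonneg _)).1 ?_
  have hs : Summable (fun k : ℤ => (1 + (k : ℝ) ^ 2) ^ μ * ‖fc f.toL2 k‖ ^ 2) := f.2
  rw [HPer.norm_eq, Real.sq_sqrt (tsum_nonneg fun k => by positivity),
    ← (hasSum_sq_norm_fc _).tsum_eq]
  refine (hasSum_sq_norm_fc _).summable.tsum_le_tsum (fun k => ?_) hs
  refine le_mul_of_one_le_left (by positivity) (Real.one_le_rpow ?_ hμ)
  nlinarith [sq_nonneg (k : ℝ)]

/-- The inclusion of `H^μ` in `L²` as a continuous linear map. -/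
def toL2CLM {μ : ℝ} (hμ : 0 ≤ μ) : HPer μ →L[ℝ] L2per :=
  HPer.toL2.mkContinuous 1 fun f => by simpa using norm_toL2_le hμ f

/-! ### Existence and stability for locally Lipschitz autonomous equations -/

section ODE

variable {E : Type*} [NormedAddCommGroup E] [NormedSpace ℝ E]

/-- The radial retraction on the ball of radius `R`. -/
def radial (R : ℝ) (x : E) : E := (R / max R ‖x‖) • x

theorem norm_radial_le {R : ℝ} (hR : 0 < R) (x : E) : ‖radial R x‖ ≤ R := by
  have hm : 0 < max R ‖x‖ := lt_max_of_lt_left hR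
  rw [radial, norm_smul, Real.norm_of_nonneg (by positivity), div_mul_eq_mul_div, div_le_iff₀ hm]
  gcongr
  exact le_max_right _ _

theorem radial_of_norm_le {R : ℝ} (hR : 0 < R) {x : E} (hx : ‖x‖ ≤ R) : radial R x = x := by
  rw [radial, max_eq_left hx, div_self hR.ne', one_smul]

/-- Rescaling the difference and changing the scaling factor each cost at most `‖x - y‖`. This uses
no inner product, as required for `L² × L²` with the maximum norm. -/
theorem lipschitzWith_radial {R : ℝ} (hR : 0 < R) : LipschitzWith 2 (radial R : E → E) := by
  refine LipschitzWith.of_dist_le_mul fun x y => ?_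
  have hx : 0 < max R ‖x‖ := lt_max_of_lt_left hR
  have hy : 0 < max R ‖y‖ := lt_max_of_lt_left hR
  have h : radial R x - radial R y
      = (R / max R ‖x‖) • (x - y) + (R / max R ‖x‖ - R / max R ‖y‖) • y := by
    simp only [radial, smul_sub, sub_smul]
    abel
  rw [dist_eq_norm, dist_eq_norm, h]
  have h1 : ‖(R / max R ‖x‖) • (x - y)‖ ≤ ‖x - y‖ := by
    rw [norm_smul, Real.norm_of_nonneg (by positivity)]
    refine mul_le_of_le_one_left (norm_nonneg _) ?_
    rw [div_le_one hx]
    exact le_max_left _ _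
  have h2 : ‖(R / max R ‖x‖ - R / max R ‖y‖) • y‖ ≤ ‖x - y‖ := by
    have h3 : |max R ‖y‖ - max R ‖x‖| ≤ ‖x - y‖ := by
      refine (abs_max_sub_max_le_max R ‖y‖ R ‖x‖).trans ?_
      rw [sub_self, abs_zero, max_eq_right (abs_nonneg _), norm_sub_rev]
      exact abs_norm_sub_norm_le y x
    have h4 : R / max R ‖x‖ - R / max R ‖y‖
        = (R / max R ‖x‖) * ((max R ‖y‖ - max R ‖x‖) / max R ‖y‖) := by
      field_simp
    rw [norm_smul, Real.norm_eq_abs, h4, abs_mul, abs_of_pos (div_pos hR hx), abs_div,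
      abs_of_pos hy, mul_assoc]
    refine (mul_le_of_le_one_left (by positivity) ?_).trans ?_
    · rw [div_le_one hx]
      exact le_max_left _ _
    · rw [div_mul_eq_mul_div, div_le_iff₀ hy]
      gcongr
      exact le_max_right _ _
  refine (norm_add_le _ _).trans ((add_le_add h1 h2).trans (le_of_eq ?_))
  norm_num
  ring

theorem hasDerivWithinAt_Ici_of_Icc {f : ℝ → E} {f' : E} {T t : ℝ}
    (h : HasDerivWithinAt f f' (Icc 0 T) t) (ht : t ∈ Ico 0 T) : HasDerivWithinAt f f' (Ici t) t :=
  (h.mono (Icc_subset_Icc_left ht.1)).mono_of_mem_nhdsWithin (Icc_mem_nhdsGE ht.2)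

/-- Uniqueness for vector fields that are Lipschitz on every ball. -/
theorem solution_unique {F : E → E} (hF : ∀ R, ∃ K, LipschitzOnWith K F (Metric.closedBall 0 R))
    {T : ℝ} {V W : ℝ → E} (hV : ∀ t ∈ Icc 0 T, HasDerivWithinAt V (F (V t)) (Icc 0 T) t)
    (hW : ∀ t ∈ Icc 0 T, HasDerivWithinAt W (F (W t)) (Icc 0 T) t) (h0 : V 0 = W 0) :
    ∀ t ∈ Icc 0 T, V t = W t := by
  have hVc : ContinuousOn V (Icc 0 T) := fun t ht => (hV t ht).continuousWithinAt
  have hWc : ContinuousOn W (Icc 0 T) := fun t ht => (hW t ht).continuousWithinAt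
  obtain ⟨R₁, h1⟩ := isCompact_Icc.exists_bound_of_continuousOn hVc
  obtain ⟨R₂, h2⟩ := isCompact_Icc.exists_bound_of_continuousOn hWc
  obtain ⟨K, hK⟩ := hF (max R₁ R₂)
  exact ODE_solution_unique_of_mem_Icc_right (v := fun _ => F)
    (s := fun _ => Metric.closedBall 0 (max R₁ R₂)) (fun _ _ => hK) hVc
    (fun t ht => hasDerivWithinAt_Ici_of_Icc (hV t (Ico_subset_Icc_self ht)) ht)
    (fun t ht => by simpa using Or.inl (h1 t (Ico_subset_Icc_self ht))) hWc
    (fun t ht => hasDerivWithinAt_Ici_of_Icc (hW t (Ico_subset_Icc_self ht)) ht)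
    (fun t ht => by simpa using Or.inr (h2 t (Ico_subset_Icc_self ht))) h0

variable [CompleteSpace E]

/-- Bounded Lipschitz vector fields have global solutions. -/
theorem exists_solution_of_bounded {F : E → E} {K : NNReal} (hF : LipschitzWith K F) {L : ℝ}
    (hL : ∀ x, ‖F x‖ ≤ L) {T : ℝ} (hT : 0 ≤ T) (x₀ : E) :
    ∃ W : ℝ → E, W 0 = x₀ ∧ ∀ t ∈ Icc 0 T, HasDerivWithinAt W (F (W t)) (Icc 0 T) t := by
  have hL0 : 0 ≤ L := (norm_nonneg _).trans (hL 0)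
  lift L to NNReal using hL0
  lift T to NNReal using hT
  -- A solution with speed at most `L` moves at most `L * T` in time `T`, so the ball of that radius
  -- lets Picard–Lindelöf reach the whole interval.
  have h : IsPicardLindelof (fun _ => F) (⟨0, le_rfl, T.2⟩ : Icc (0 : ℝ) T) x₀ (L * T) 0 L K :=
    { lipschitzOnWith := fun _ _ => hF.lipschitzOnWith
      continuousOn := fun _ _ => continuousOn_const
      norm_le := fun _ _ x _ => hL x
      mul_max_le := by simp }
  exact h.exists_eq_forall_mem_Icc_hasDerivWithinAt₀

/-- Near an approximate solution of `W' = F(W)` there is an exact solution. -/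
theorem exists_solution_near {F : E → E} {K : NNReal} {R : ℝ} (hR : 0 < R)
    (hF : LipschitzOnWith K F (Metric.closedBall 0 R)) {T : ℝ} (hT : 0 ≤ T) {V V' : ℝ → E}
    (hV : ∀ t ∈ Icc 0 T, HasDerivWithinAt V (V' t) (Icc 0 T) t) (hVR : ∀ t ∈ Icc 0 T, ‖V t‖ + 1 ≤ R)
    {δ ε : ℝ} (hε : ∀ t ∈ Icc 0 T, ‖V' t - F (V t)‖ ≤ ε) {x₀ : E} (hδ : ‖V 0 - x₀‖ ≤ δ)
    (hsmall : gronwallBound δ (K * 2 : NNReal) ε T ≤ 1) :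
    ∃ W : ℝ → E, W 0 = x₀ ∧ ∀ t ∈ Icc 0 T,
      HasDerivWithinAt W (F (W t)) (Icc 0 T) t ∧ ‖W t‖ ≤ R ∧
      ‖V t - W t‖ ≤ gronwallBound δ (K * 2 : NNReal) ε T := by
  have hδ0 : 0 ≤ δ := (norm_nonneg _).trans hδ
  have hε0 : 0 ≤ ε := (norm_nonneg _).trans (hε 0 ⟨le_rfl, hT⟩)
  have hmem : ∀ x : E, radial R x ∈ Metric.closedBall (0 : E) R := fun x => by
    simpa using norm_radial_le hR x
  -- Composing with the retraction makes the field globally Lipschitz and bounded; the factor `2` is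
  -- the Lipschitz constant of `radial`.
  have hG : LipschitzWith (K * 2) (fun x => F (radial R x)) := by
    have := hF.comp (lipschitzWith_radial (E := E) hR).lipschitzOnWith (s := univ)
      (fun x _ => hmem x)
    rwa [lipschitzOnWith_univ] at this
  have hGb : ∀ x : E, ‖F (radial R x)‖ ≤ ‖F 0‖ + K * R := fun x => by
    have h := hF.dist_le_mul _ (hmem x) 0 (Metric.mem_closedBall_self hR.le)
    rw [dist_eq_norm, dist_zero_right] at h
    calc ‖F (radial R x)‖ = ‖F 0 + (F (radial R x) - F 0)‖ := by rw [add_sub_cancel]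
      _ ≤ ‖F 0‖ + ‖F (radial R x) - F 0‖ := norm_add_le _ _
      _ ≤ ‖F 0‖ + K * R := by
          gcongr
          exact h.trans (by gcongr; exact norm_radial_le hR x)
  obtain ⟨W, hW0, hW⟩ := exists_solution_of_bounded hG hGb hT x₀
  have hVle : ∀ t ∈ Icc 0 T, ‖V t‖ ≤ R := fun t ht => by linarith [hVR t ht]
  have hdist : ∀ t ∈ Icc 0 T, ‖V t - W t‖ ≤ gronwallBound δ (K * 2 : NNReal) ε T := by
    intro t ht
    have h := dist_le_of_approx_trajectories_ODE (v := fun _ x => F (radial R x)) (εf := ε)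
      (εg := 0) (δ := δ) (f' := V') (g' := fun t => F (radial R (W t))) (fun _ => hG)
      (fun t ht => (hV t ht).continuousWithinAt)
      (fun t ht => hasDerivWithinAt_Ici_of_Icc (hV t (Ico_subset_Icc_self ht)) ht)
      (fun t ht => by
        rw [radial_of_norm_le hR (hVle t (Ico_subset_Icc_self ht)), dist_eq_norm]
        exact hε t (Ico_subset_Icc_self ht))
      (fun t ht => (hW t ht).continuousWithinAt)
      (fun t ht => hasDerivWithinAt_Ici_of_Icc (hW t (Ico_subset_Icc_self ht)) ht)
      (fun t ht => by simp)
      (by rwa [hW0, dist_eq_norm]) t ht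
    rw [dist_eq_norm, add_zero, sub_zero] at h
    exact h.trans (gronwallBound_mono hδ0 hε0 (by positivity) ht.2)
  -- `V` keeps distance `1` from the sphere of radius `R`, and `W` is within `1` of `V`; hence the
  -- retraction acts trivially along `W`, which solves the original equation.
  have hWR : ∀ t ∈ Icc 0 T, ‖W t‖ ≤ R := fun t ht => by
    have h1 := hdist t ht
    have h2 := hVR t ht
    have h3 := norm_sub_norm_le (W t) (V t)
    rw [norm_sub_rev] at h3
    linarith
  refine ⟨W, hW0, fun t ht => ⟨?_, hWR t ht, hdist t ht⟩⟩
  have h := hW t ht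
  simp only [radial_of_norm_le hR (hWR t ht)] at h
  exact h

/-- Grönwall's bound is linear in the initial error and the residual together, so a common factor
`N^{-μ}` can be pulled out. -/
theorem gronwallBound_mul (c δ K ε x : ℝ) :
    gronwallBound (δ * c) K (ε * c) x = gronwallBound δ K ε x * c := by
  unfold gronwallBound
  split_ifs <;> ring

end ODE

/-! ### The Galerkin vector field -/

/-- The symbol of `-(1 - b∂²)⁻¹∂`. -/
def symb (b : ℝ) (k : ℤ) : ℂ :=
  -(2 * Real.pi * Complex.I * k) / ((1 + b * (2 * Real.pi * k) ^ 2 : ℝ) : ℂ)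

theorem symb_isHermitian (b : ℝ) : IsHermitian (symb b) := by
  intro k
  simp only [symb, map_div₀, map_neg, map_mul, Complex.conj_I, Complex.conj_ofReal, map_ofNat,
    map_intCast]
  push_cast
  ring

theorem symb_denom_pos {b : ℝ} (hb : 0 < b) (k : ℤ) : 0 < 1 + b * (2 * Real.pi * k) ^ 2 := by
  positivity

/-- The summand `1` in the denominator is dropped. At `k = 0` both sides vanish, since `1 / 0 = 0`.
-/
theorem symb_norm_sq_le {b : ℝ} (hb : 0 < b) (k : ℤ) :
    ‖symb b k‖ ^ 2 ≤ (1 / (2 * Real.pi * b)) ^ 2 * (1 / (k : ℝ) ^ 2) := by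
  rcases eq_or_ne k 0 with rfl | hk
  · simp [symb]
  have hk' : (k : ℝ) ≠ 0 := by exact_mod_cast hk
  have hpi := Real.pi_pos
  have h1 : ‖symb b k‖ ≤ 1 / (2 * Real.pi * b) * (1 / |(k : ℝ)|) := by
    have hk0 : 0 < |(k : ℝ)| := abs_pos.2 hk'
    have : ‖symb b k‖ = 2 * Real.pi * |(k : ℝ)| / (1 + b * (2 * Real.pi * k) ^ 2) := by
      rw [symb, norm_div, Complex.norm_real, Real.norm_of_nonneg (symb_denom_pos hb k).le]
      simp [abs_of_pos hpi]
    rw [this, div_le_iff₀ (symb_denom_pos hb k), div_mul_div_comm, div_mul_eq_mul_div,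
      le_div_iff₀ (by positivity), ← sq_abs (2 * Real.pi * (k : ℝ)), abs_mul (2 * Real.pi),
      abs_of_pos (by positivity : 0 < 2 * Real.pi)]
    nlinarith
  calc ‖symb b k‖ ^ 2 ≤ (1 / (2 * Real.pi * b) * (1 / |(k : ℝ)|)) ^ 2 := by gcongr
    _ = _ := by rw [mul_pow, div_pow 1 |(k : ℝ)|, sq_abs, one_pow]

/-- The symbol is square summable. -/
theorem exists_symb_bound {b : ℝ} (hb : 0 < b) :
    ∃ M : ℝ, 0 ≤ M ∧ ∀ s : Finset ℤ, ∑ k ∈ s, ‖symb b k‖ ^ 2 ≤ M ^ 2 := by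
  have hs : Summable (fun k : ℤ => (1 / (2 * Real.pi * b)) ^ 2 * (1 / (k : ℝ) ^ 2)) :=
    (Real.summable_one_div_int_pow.2 one_lt_two).mul_left _
  refine ⟨Real.sqrt (∑' k : ℤ, (1 / (2 * Real.pi * b)) ^ 2 * (1 / (k : ℝ) ^ 2)),
    Real.sqrt_nonneg _, fun s => ?_⟩
  rw [Real.sq_sqrt (tsum_nonneg fun k => by positivity)]
  exact (Finset.sum_le_sum fun k _ => symb_norm_sq_le hb k).trans
    (hs.sum_le_tsum _ fun k _ => by positivity)

/-- `-P(1 - b∂²)⁻¹∂(κ f + λ g h)`. -/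
def field (N : ℕ) (b κ lam : ℝ) (f g h : L2per) : L2per :=
  synth N fun k => symb b k * (κ * fc f k + lam * pc g h k)

theorem fc_field (N : ℕ) (b κ lam : ℝ) (f g h : L2per) (k : ℤ) :
    fc (field N b κ lam f g h) k
      = if k ∈ band N then symb b k * (κ * fc f k + lam * pc g h k) else 0 := by
  refine fc_synth (fun k => ?_) N k
  simp only [symb_isHermitian b k, fc_isHermitian f k, pc_isHermitian g h k, map_mul, map_add,
    Complex.conj_ofReal]

/-- The coefficients of the difference are bounded uniformly in `k` by the bracket on the right;
multiplying by the symbol, whose `ℓ²` norm is at most `M`, yields an `L²` bound in which `N` does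
not appear. -/
theorem norm_field_sub_le {b M : ℝ} (hM : 0 ≤ M)
    (hs : ∀ s : Finset ℤ, ∑ k ∈ s, ‖symb b k‖ ^ 2 ≤ M ^ 2) (N : ℕ) (κ lam : ℝ)
    (f g h f' g' h' : L2per) :
    ‖field N b κ lam f g h - field N b κ lam f' g' h'‖
      ≤ M * (|κ| * ‖f - f'‖ + |lam| * (‖g - g'‖ * ‖h‖ + ‖g'‖ * ‖h - h'‖)) := by
  rw [field, field, ← synth_sub]
  set A := |κ| * ‖f - f'‖ + |lam| * (‖g - g'‖ * ‖h‖ + ‖g'‖ * ‖h - h'‖)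
  have hA : 0 ≤ A := by positivity
  refine norm_synth_le (mul_nonneg hM hA) N ?_
  calc _ ≤ ∑ k ∈ band N, ‖symb b k‖ ^ 2 * A ^ 2 := by
        refine Finset.sum_le_sum fun k _ => ?_
        rw [← mul_pow]
        refine pow_le_pow_left₀ (norm_nonneg _) ?_ 2
        have : symb b k * (κ * fc f k + lam * pc g h k)
            - symb b k * (κ * fc f' k + lam * pc g' h' k)
            = symb b k * (κ * fc (f - f') k + lam * (pc g h k - pc g' h' k)) := by
          rw [fc_sub]; ring
        rw [this, norm_mul]
        gcongr
        refine (norm_add_le _ _).trans ?_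
        rw [norm_mul, norm_mul, Complex.norm_real, Complex.norm_real, Real.norm_eq_abs,
          Real.norm_eq_abs]
        exact add_le_add (mul_le_mul_of_nonneg_left (norm_fc_le _ _) (abs_nonneg _))
          (mul_le_mul_of_nonneg_left (norm_pc_sub_le _ _ _ _ _) (abs_nonneg _))
    _ = (∑ k ∈ band N, ‖symb b k‖ ^ 2) * A ^ 2 := by rw [Finset.sum_mul]
    _ ≤ (M * A) ^ 2 := by
        rw [mul_pow]
        gcongr
        exact hs _

/-- The vector field of the Galerkin system for the pair `(ζ, u)`. -/
def galerkinField (κ₁ κ₂ lam b d : ℝ) (N : ℕ) (v : L2per × L2per) : L2per × L2per :=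
  (field N b κ₁ lam v.2 v.1 v.2, field N d κ₂ (lam / 2) v.1 v.2 v.2)

/-- The Galerkin vector fields are Lipschitz on balls, uniformly in `N`. -/
theorem galerkinField_lipschitzOn (κ₁ κ₂ lam : ℝ) {b d : ℝ} (hb : 0 < b) (hd : 0 < d) (R : ℝ) :
    ∃ K : NNReal, ∀ N, LipschitzOnWith K (galerkinField κ₁ κ₂ lam b d N)
      (Metric.closedBall 0 R) := by
  obtain ⟨M, hM, hsM⟩ := exists_symb_bound hb
  obtain ⟨M', hM', hsM'⟩ := exists_symb_bound hd
  refine ⟨Real.toNNReal (max (M * (|κ₁| + |lam| * (R + R))) (M' * (|κ₂| + |lam / 2| * (R + R)))),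
    fun N => LipschitzOnWith.of_dist_le_mul fun v hv w hw => ?_⟩
  rw [mem_closedBall_zero_iff] at hv hw
  have h1 := (norm_fst_le v).trans hv
  have h2 := (norm_snd_le v).trans hv
  have h3 := (norm_fst_le w).trans hw
  have h4 := (norm_snd_le w).trans hw
  have h5 : ‖v.1 - w.1‖ ≤ ‖v - w‖ := norm_fst_le (v - w)
  have h6 : ‖v.2 - w.2‖ ≤ ‖v - w‖ := norm_snd_le (v - w)
  have key : ∀ (M κ l : ℝ), 0 ≤ M → ∀ f g h f' g' h' : L2per, ‖f - f'‖ ≤ ‖v - w‖ →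
      ‖g - g'‖ ≤ ‖v - w‖ → ‖h - h'‖ ≤ ‖v - w‖ → ‖h‖ ≤ R → ‖g'‖ ≤ R →
      M * (|κ| * ‖f - f'‖ + |l| * (‖g - g'‖ * ‖h‖ + ‖g'‖ * ‖h - h'‖))
        ≤ M * (|κ| + |l| * (R + R)) * ‖v - w‖ := by
    intro M κ l hM f g h f' g' h' hf hg hh hR hR'
    have hR0 := (norm_nonneg _).trans hR
    calc _ ≤ M * (|κ| * ‖v - w‖ + |l| * (‖v - w‖ * R + R * ‖v - w‖)) := by gcongr
      _ = _ := by ring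
  rw [dist_eq_norm, dist_eq_norm]
  refine (mul_le_mul_of_nonneg_right (Real.le_coe_toNNReal _) (norm_nonneg _)).trans' ?_
  refine (norm_prod_le_iff).2 ⟨?_, ?_⟩
  · refine (norm_field_sub_le hM hsM N κ₁ lam v.2 v.1 v.2 w.2 w.1 w.2).trans
      ((key M κ₁ lam hM _ _ _ _ _ _ h6 h5 h6 h2 h3).trans ?_)
    gcongr
    exact le_max_left _ _
  · refine (norm_field_sub_le hM' hsM' N κ₂ (lam / 2) v.1 v.2 v.2 w.1 w.2 w.2).trans
      ((key M' κ₂ (lam / 2) hM' _ _ _ _ _ _ h5 h6 h6 h2 h4).trans ?_)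
    gcongr
    exact le_max_right _ _

/-! ### Integrals over a period -/

theorem intervalIntegral_coe {E : Type*} [NormedAddCommGroup E] [NormedSpace ℝ E]
    (h : AddCircle (1 : ℝ) → E) : ∫ x in (0 : ℝ)..1, h x = ∫ x, h x ∂haar := by
  have h1 := AddCircle.intervalIntegral_preimage (1 : ℝ) 0 h
  rw [zero_add] at h1
  rw [h1, AddCircle.integral_haarAddCircle, inv_one, one_smul]

theorem expo_eq_fourier (k : ℤ) (x : ℝ) : expo k x = fourier k (x : AddCircle (1 : ℝ)) := by
  rw [fourier_coe_apply, expo]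
  congr 1
  push_cast
  ring

theorem expo_add (k l : ℤ) (x : ℝ) : expo (k + l) x = expo k x * expo l x := by
  simp only [expo_eq_fourier, fourier_add]

theorem conj_expo (k : ℤ) (x : ℝ) : conj (expo k x) = expo (-k) x := by
  simp only [expo_eq_fourier, fourier_neg]

theorem expo_isHermitian (x : ℝ) : IsHermitian (fun k => expo k x) := fun k => (conj_expo k x).symm

theorem expo_periodic (k : ℤ) : Function.Periodic (expo k) 1 := by
  intro x
  rw [expo_eq_fourier, expo_eq_fourier, AddCircle.coe_add_period]

theorem expo_contDiff (k : ℤ) : ContDiff ℝ ∞ (expo k) := by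
  unfold expo
  have : ContDiff ℝ ∞ (fun x : ℝ => (x : ℂ)) := Complex.ofRealCLM.contDiff
  fun_prop

theorem hasDerivAt_expo (k : ℤ) (x : ℝ) :
    HasDerivAt (expo k) (2 * Real.pi * Complex.I * k * expo k x) x := by
  have h : HasDerivAt (fun x : ℝ => 2 * Real.pi * Complex.I * k * (x : ℂ))
      (2 * Real.pi * Complex.I * k) x := by
    simpa using (Complex.ofRealCLM.hasDerivAt (x := x)).const_mul (2 * Real.pi * Complex.I * k)
  rw [mul_comm]
  exact h.cexp

theorem deriv_expo (k : ℤ) : deriv (expo k) = fun x => 2 * Real.pi * Complex.I * k * expo k x :=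
  funext fun x => (hasDerivAt_expo k x).deriv

theorem iteratedDeriv_two_expo (k : ℤ) :
    iteratedDeriv 2 (expo k) = fun x => (2 * Real.pi * Complex.I * k) ^ 2 * expo k x := by
  rw [iteratedDeriv_succ, iteratedDeriv_one, deriv_expo]
  ext x
  rw [deriv_const_mul_field, deriv_expo]
  ring

theorem ip_coe_expo (h : AddCircle (1 : ℝ) → ℝ) (k : ℤ) :
    ip (fun x => h x) (expo k) = fourierCoeff (fun x => (h x : ℂ)) k := by
  have h1 := intervalIntegral_coe (fun x => fourier (-k) x • (h x : ℂ))
  rw [fourierCoeff, ← h1, ip]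
  refine intervalIntegral.integral_congr fun x _ => ?_
  rw [conj_expo, expo_eq_fourier, smul_eq_mul, mul_comm]

theorem ip_const_mul (f : ℝ → ℝ) (φ : ℝ → ℂ) (c : ℂ) :
    ip f (fun x => c * φ x) = conj c * ip f φ := by
  simp only [ip, map_mul]
  rw [← intervalIntegral.integral_const_mul]
  congr 1
  ext x
  ring

/-- The Fourier coefficients of the time derivative of an exact solution. -/
theorem fc_eq_symb_mul {b κ lam : ℝ} (hb : 0 < b) {f' f g h : L2per}
    (heq : ∀ φ : ℝ → ℂ, ContDiff ℝ ∞ φ → Function.Periodic φ 1 →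
      ip (fun x => f' (x : AddCircle (1 : ℝ))) φ
        - κ * ip (fun x => f (x : AddCircle (1 : ℝ))) (deriv φ)
        - lam * ip (fun x => g (x : AddCircle (1 : ℝ)) * h (x : AddCircle (1 : ℝ))) (deriv φ)
        - ((0 : ℝ) : ℂ) * ip (fun x => f (x : AddCircle (1 : ℝ))) (iteratedDeriv 3 φ)
        - b * ip (fun x => f' (x : AddCircle (1 : ℝ))) (iteratedDeriv 2 φ) = 0) (k : ℤ) :
    fc f' k = symb b k * (κ * fc f k + lam * pc g h k) := by
  -- Exponentials are admissible test functions and diagonalize the derivatives. The term with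
  -- coefficient `0` is the absent dispersive one.
  have h0 := heq (expo k) (expo_contDiff k) (expo_periodic k)
  rw [deriv_expo, iteratedDeriv_two_expo, ip_const_mul, ip_const_mul, ip_const_mul, ip_coe_expo,
    ip_coe_expo, ip_coe_expo (fun x => g x * h x)] at h0
  change fc f' k - κ * (_ * fc f k) - lam * (_ * pc g h k) - _ - b * (_ * fc f' k) = 0 at h0
  have hd : ((1 + b * (2 * Real.pi * k) ^ 2 : ℝ) : ℂ) ≠ 0 :=
    Complex.ofReal_ne_zero.2 (symb_denom_pos hb k).ne'
  rw [symb, div_mul_eq_mul_div, eq_div_iff hd]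
  simp only [map_mul, map_pow, Complex.conj_I, Complex.conj_ofReal, map_ofNat, map_intCast,
    Complex.ofReal_zero, zero_mul] at h0
  push_cast
  linear_combination h0 + b * (2 * Real.pi * k) ^ 2 * fc f' k * (Complex.I_sq)

/-! ### Trigonometric polynomials on the line -/

/-- The real trigonometric polynomial with the coefficients of `f` in the band. -/
def trig (N : ℕ) (f : L2per) : ℝ → ℝ := fun x => (proj N f x).re

theorem ofReal_trig (N : ℕ) (f : L2per) (x : ℝ) : (trig N f x : ℂ) = proj N f x := by
  rw [trig, ← Complex.conj_eq_iff_re, Complex.conj_eq_iff_im]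
  exact (fc_isHermitian f).sum_im (expo_isHermitian x) N

theorem sum_expo_mem_trigSpace (N : ℕ) (c : ℤ → ℂ) :
    (fun x => ∑ k ∈ band N, c k * expo k x) ∈ trigSpace N := by
  have : (fun x => ∑ k ∈ band N, c k * expo k x) = ∑ k ∈ band N, c k • expo k := by
    ext x
    simp
  rw [this]
  refine Submodule.sum_mem _ fun k hk => Submodule.smul_mem _ _ (Submodule.subset_span ⟨k, ?_, rfl⟩)
  simpa using hk

theorem trig_mem_trigSpace (N : ℕ) (f : L2per) : (fun x => (trig N f x : ℂ)) ∈ trigSpace N := by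
  simp only [ofReal_trig]
  exact sum_expo_mem_trigSpace N _

theorem contDiff_trig (N : ℕ) (f : L2per) : ContDiff ℝ ∞ (trig N f) := by
  have h : ContDiff ℝ ∞ (fun x => proj N f x) :=
    ContDiff.sum fun k _ => contDiff_const.mul (expo_contDiff k)
  exact Complex.reCLM.contDiff.comp h

theorem periodic_trig (N : ℕ) (f : L2per) : Function.Periodic (trig N f) 1 := by
  intro x
  simp only [trig, proj, expo_periodic _ x]

/-- Elements of `L²` all of whose frequencies are in the band. -/
def InBand (N : ℕ) (f : L2per) : Prop := projL2 N f = f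

theorem inBand_of_fc {N : ℕ} {f : L2per} (h : ∀ k, k ∉ band N → fc f k = 0) : InBand N f :=
  fc_ext fun k => by
    rw [fc_projL2]
    split_ifs with hk
    · rfl
    · exact (h k hk).symm

theorem InBand.fc_eq_zero {N : ℕ} {f : L2per} (h : InBand N f) {k : ℤ} (hk : k ∉ band N) :
    fc f k = 0 := by
  rw [← h, fc_projL2, if_neg hk]

theorem inBand_projL2 (N : ℕ) (f : L2per) : InBand N (projL2 N f) :=
  inBand_of_fc fun k hk => by rw [fc_projL2, if_neg hk]

theorem inBand_field (N : ℕ) (b κ lam : ℝ) (f g h : L2per) : InBand N (field N b κ lam f g h) :=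
  inBand_of_fc fun k hk => by rw [fc_field, if_neg hk]

/-- The trigonometric polynomial `trig N f` on the circle. -/
def trigCircle (N : ℕ) (f : L2per) (x : AddCircle (1 : ℝ)) : ℝ :=
  (∑ k ∈ band N, fc f k * fourier k x).re

theorem trig_eq_trigCircle (N : ℕ) (f : L2per) (x : ℝ) : trig N f x = trigCircle N f x := by
  simp only [trig, proj, trigCircle, expo_eq_fourier]

theorem InBand.ae_eq {N : ℕ} {f : L2per} (h : InBand N f) : f =ᵐ[haar] trigCircle N f := by
  have h1 := coeFn_synth N (fc f)
  rw [show synth N (fc f) = f from h] at h1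
  exact h1

theorem InBand.l2norm_sub {N : ℕ} {f : L2per} (h : InBand N f) (g : L2per) :
    l2norm (fun x => trig N f x - g (x : AddCircle (1 : ℝ))) = ‖f - g‖ := by
  have h1 := intervalIntegral_coe (fun x => (trigCircle N f x - g x) ^ 2)
  have h2 : ∫ x, (trigCircle N f x - g x) ^ 2 ∂haar = ‖f - g‖ ^ 2 := by
    rw [← real_inner_self_eq_norm_sq, L2.inner_def]
    refine integral_congr_ae ?_
    filter_upwards [Lp.coeFn_sub f g, h.ae_eq] with x hx hx'
    simp only [hx, Pi.sub_apply, hx', inner_self_eq_norm_sq_to_K]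
    simp
  simp only [l2norm, trig_eq_trigCircle]
  rw [h1, h2, Real.sqrt_sq (norm_nonneg _)]

theorem ip_trig_expo {N : ℕ} {f : L2per} (h : InBand N f) (k : ℤ) :
    ip (trig N f) (expo k) = fc f k := by
  have h1 : trig N f = fun x : ℝ => trigCircle N f x := funext (trig_eq_trigCircle N f)
  rw [h1, ip_coe_expo, fc]
  refine congrFun (fourierCoeff_congr_ae ?_) k
  filter_upwards [h.ae_eq] with x hx
  rw [hx]

theorem ip_trig_mul_trig_expo {N : ℕ} {f g : L2per} (hf : InBand N f) (hg : InBand N g) (k : ℤ) :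
    ip (fun x => trig N f x * trig N g x) (expo k) = pc f g k := by
  simp only [trig_eq_trigCircle]
  rw [ip_coe_expo (fun x => trigCircle N f x * trigCircle N g x), pc]
  refine congrFun (fourierCoeff_congr_ae ?_) k
  filter_upwards [hf.ae_eq, hg.ae_eq] with x hx hx'
  rw [hx, hx']

/-- Integration by parts against an exponential. -/
theorem ip_deriv_expo {f : ℝ → ℝ} (hf : ContDiff ℝ ∞ f) (hp : Function.Periodic f 1) (k : ℤ) :
    ip (deriv f) (expo k) = 2 * Real.pi * Complex.I * k * ip f (expo k) := by
  have hd : ∀ x, HasDerivAt (fun x => (f x : ℂ)) ((deriv f x : ℝ) : ℂ) x := fun x =>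
    ((hf.differentiable (by simp)).differentiableAt.hasDerivAt).ofReal_comp
  have hc : Continuous (deriv f) := hf.continuous_deriv (by simp)
  have he : Continuous (expo (-k)) := (expo_contDiff _).continuous
  have h := intervalIntegral.integral_deriv_mul_eq_sub (a := 0) (b := 1)
    (u := fun x : ℝ => (f x : ℂ)) (v := expo (-k)) (u' := fun x : ℝ => ((deriv f x : ℝ) : ℂ))
    (v' := fun x => 2 * Real.pi * Complex.I * ((-k : ℤ) : ℂ) * expo (-k) x)
    (fun x _ => hd x) (fun x _ => hasDerivAt_expo (-k) x)
    ((Complex.continuous_ofReal.comp hc).intervalIntegrable _ _)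
    ((continuous_const.mul he).intervalIntegrable _ _)
  have hp1 : f 1 = f 0 := by simpa using hp 0
  have hp2 : expo (-k) 1 = expo (-k) 0 := by simpa using expo_periodic (-k) 0
  -- By periodicity the boundary terms cancel.
  rw [hp1, hp2, sub_self, intervalIntegral.integral_add] at h
  · rw [← eq_neg_iff_add_eq_zero] at h
    simp only [ip, conj_expo]
    rw [h, ← intervalIntegral.integral_neg, ← intervalIntegral.integral_const_mul]
    congr 1
    ext x
    push_cast
    ring
  · exact ((Complex.continuous_ofReal.comp hc).mul he).intervalIntegrable _ _
  · exact ((Complex.continuous_ofReal.comp hf.continuous).mul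
      (continuous_const.mul he)).intervalIntegrable _ _

theorem periodic_deriv {f : ℝ → ℝ} (hp : Function.Periodic f 1) :
    Function.Periodic (deriv f) 1 := by
  intro x
  rw [← deriv_comp_add_const]
  congr 1
  ext y
  exact hp y

theorem ip_iteratedDeriv_two_expo {f : ℝ → ℝ} (hf : ContDiff ℝ ∞ f) (hp : Function.Periodic f 1)
    (k : ℤ) : ip (iteratedDeriv 2 f) (expo k) = (2 * Real.pi * Complex.I * k) ^ 2 * ip f (expo k) := by
  have hf' : ContDiff ℝ ∞ (deriv f) := (contDiff_infty_iff_deriv.1 hf).2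
  rw [iteratedDeriv_succ, iteratedDeriv_one, ip_deriv_expo hf' (periodic_deriv hp),
    ip_deriv_expo hf hp]
  ring

/-- The Galerkin functional evaluated at an exponential. -/
theorem galerkin_expo {N : ℕ} {f' f g h : L2per} (hf' : InBand N f') (hf : InBand N f)
    (hg : InBand N g) (hh : InBand N h) (b κ lam : ℝ) (k : ℤ) :
    ip (trig N f') (expo k) + κ * ip (deriv (trig N f)) (expo k)
        + lam * ip (deriv (fun x => trig N g x * trig N h x)) (expo k)
        - b * ip (iteratedDeriv 2 (trig N f')) (expo k)
      = ((1 + b * (2 * Real.pi * k) ^ 2 : ℝ) : ℂ) * fc f' k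
        + 2 * Real.pi * Complex.I * k * (κ * fc f k + lam * pc g h k) := by
  rw [ip_deriv_expo (contDiff_trig N f) (periodic_trig N f),
    ip_deriv_expo ((contDiff_trig N g).mul (contDiff_trig N h))
      ((periodic_trig N g).mul (periodic_trig N h)),
    ip_iteratedDeriv_two_expo (contDiff_trig N f') (periodic_trig N f'), ip_trig_expo hf',
    ip_trig_expo hf, ip_trig_mul_trig_expo hg hh]
  push_cast
  linear_combination -b * (2 * Real.pi * k) ^ 2 * fc f' k * Complex.I_sq

/-- The Galerkin equation at an exponential determines a Fourier coefficient. -/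
theorem galerkin_expo_iff {N : ℕ} {f' f g h : L2per} (hf' : InBand N f') (hf : InBand N f)
    (hg : InBand N g) (hh : InBand N h) {b : ℝ} (hb : 0 < b) (κ lam : ℝ) (k : ℤ) :
    ip (trig N f') (expo k) + κ * ip (deriv (trig N f)) (expo k)
        + lam * ip (deriv (fun x => trig N g x * trig N h x)) (expo k)
        - b * ip (iteratedDeriv 2 (trig N f')) (expo k) = 0
      ↔ fc f' k = symb b k * (κ * fc f k + lam * pc g h k) := by
  have hd : ((1 + b * (2 * Real.pi * k) ^ 2 : ℝ) : ℂ) ≠ 0 :=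
    Complex.ofReal_ne_zero.2 (symb_denom_pos hb k).ne'
  rw [galerkin_expo hf' hf hg hh, symb, div_mul_eq_mul_div, eq_div_iff hd]
  constructor <;> intro h <;> linear_combination h

theorem ip_zero_right (f : ℝ → ℝ) : ip f 0 = 0 := by simp [ip]

theorem ip_add_right {f : ℝ → ℝ} (hf : Continuous f) {φ ψ : ℝ → ℂ} (hφ : Continuous φ)
    (hψ : Continuous ψ) : ip f (φ + ψ) = ip f φ + ip f ψ := by
  simp only [ip, Pi.add_apply, map_add, mul_add]
  have hf' : Continuous fun x => (f x : ℂ) := Complex.continuous_ofReal.comp hf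
  exact intervalIntegral.integral_add
    ((hf'.mul (Complex.continuous_conj.comp hφ)).intervalIntegrable _ _)
    ((hf'.mul (Complex.continuous_conj.comp hψ)).intervalIntegrable _ _)

theorem continuous_of_mem_trigSpace {N : ℕ} {φ : ℝ → ℂ} (h : φ ∈ trigSpace N) : Continuous φ := by
  refine Submodule.span_induction ?_ ?_ ?_ ?_ h
  · rintro _ ⟨k, _, rfl⟩
    exact (expo_contDiff k).continuous
  · exact continuous_const
  · intro _ _ _ _ h1 h2
    exact h1.add h2
  · intro c _ _ h1
    exact h1.const_smul c

/-- It is enough to test the Galerkin equation with exponentials. -/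
theorem galerkin_of_expo {N : ℕ} {f' f g h : ℝ → ℝ} (h1 : Continuous f') (h2 : Continuous f)
    (h3 : Continuous g) (h4 : Continuous h) {κ lam b : ℂ}
    (he : ∀ k ∈ band N, ip f' (expo k) + κ * ip f (expo k) + lam * ip g (expo k)
      - b * ip h (expo k) = 0) {φ : ℝ → ℂ} (hφ : φ ∈ trigSpace N) :
    ip f' φ + κ * ip f φ + lam * ip g φ - b * ip h φ = 0 := by
  refine Submodule.span_induction ?_ ?_ ?_ ?_ hφ
  · rintro _ ⟨k, hk, rfl⟩
    exact he k (by simpa using hk)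
  · simp [ip_zero_right]
  · intro φ ψ hφ hψ e1 e2
    have c1 := continuous_of_mem_trigSpace hφ
    have c2 := continuous_of_mem_trigSpace hψ
    rw [ip_add_right h1 c1 c2, ip_add_right h2 c1 c2, ip_add_right h3 c1 c2,
      ip_add_right h4 c1 c2]
    linear_combination e1 + e2
  · intro c φ _ e
    have hc : ∀ q : ℝ → ℝ, ip q (c • φ) = conj c * ip q φ := fun q => ip_const_mul q φ c
    rw [hc, hc, hc, hc]
    linear_combination conj c * e

/-! ### The discrete Fourier transform on the trigonometric polynomials -/

/-- The discrete Fourier coefficients from the values at `2N + 1` equidistant points. -/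
def dft (N : ℕ) (φ : ℝ → ℂ) (k : ℤ) : ℂ :=
  ((2 * N + 1 : ℕ) : ℂ)⁻¹ * ∑ j ∈ Finset.range (2 * N + 1),
    φ (j / (2 * N + 1 : ℕ)) * expo (-k) (j / (2 * N + 1 : ℕ))

theorem expo_mul_natCast (l : ℤ) (j : ℕ) (x : ℝ) : expo l (j * x) = expo l x ^ j := by
  simp only [expo]
  rw [← Complex.exp_nat_mul]
  congr 1
  push_cast
  ring

/-- This is a geometric sum over an `M`-th root of unity, which differs from `1` because `M` does
not divide `l`. -/
theorem sum_expo_eq_zero {l : ℤ} (hl : l ≠ 0) {M : ℕ} (hM : |l| < M) :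
    ∑ j ∈ Finset.range M, expo l (j / M) = 0 := by
  have hM0 : (M : ℝ) ≠ 0 := by
    have : (0 : ℤ) < M := (abs_nonneg l).trans_lt hM
    have : 0 < M := by exact_mod_cast this
    positivity
  have h1 : ∀ j : ℕ, expo l (j / M) = expo l (1 / M) ^ j := fun j => by
    rw [← expo_mul_natCast, mul_one_div]
  have h2 : expo l (1 / M) ^ M = 1 := by
    have h : expo l 1 = expo l 0 := by simpa using expo_periodic l 0
    rw [← expo_mul_natCast, mul_one_div_cancel hM0, h]
    simp [expo]
  have h3 : expo l (1 / M) ≠ 1 := by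
    intro h
    rw [expo, Complex.exp_eq_one_iff] at h
    obtain ⟨n, hn⟩ := h
    have hM0' : (M : ℂ) ≠ 0 := by exact_mod_cast hM0
    have h4 : (l : ℂ) = n * M := by
      push_cast at hn
      field_simp at hn
      linear_combination hn
    have h5 : l = n * M := by exact_mod_cast h4
    have hn0 : n ≠ 0 := by
      rintro rfl
      simp at h5
      exact hl h5
    have h6 : |l| = |n| * M := by rw [h5, abs_mul, Nat.abs_cast]
    have h7 := Int.one_le_abs hn0
    nlinarith
  simp_rw [h1]
  rw [geom_sum_eq h3, h2, sub_self, zero_div]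

/-- Two frequencies in the band differ by at most `2N < 2N + 1`, so `2N + 1` sample points exclude
aliasing. -/
theorem dft_expo {N : ℕ} {k l : ℤ} (hk : k ∈ band N) (hl : l ∈ band N) :
    dft N (expo l) k = if l = k then 1 else 0 := by
  simp only [dft, ← expo_add]
  split_ifs with h
  · subst h
    have h0 : ∀ x, expo (l + -l) x = 1 := fun x => by simp [expo]
    simp only [h0, Finset.sum_const, Finset.card_range, nsmul_eq_mul, mul_one]
    exact inv_mul_cancel₀ (Nat.cast_ne_zero.2 (by omega))
  · rw [sum_expo_eq_zero, mul_zero]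
    · omega
    · simp only [Finset.mem_Icc] at hk hl
      rw [abs_lt]
      push_cast
      omega

theorem dft_add (N : ℕ) (φ ψ : ℝ → ℂ) (k : ℤ) : dft N (φ + ψ) k = dft N φ k + dft N ψ k := by
  simp only [dft, Pi.add_apply, add_mul, Finset.sum_add_distrib, mul_add]

theorem dft_smul (N : ℕ) (c : ℂ) (φ : ℝ → ℂ) (k : ℤ) : dft N (c • φ) k = c * dft N φ k := by
  simp only [dft, Pi.smul_apply, smul_eq_mul, mul_assoc, ← Finset.mul_sum]
  ring

theorem dft_zero (N : ℕ) (k : ℤ) : dft N 0 k = 0 := by simp [dft]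

theorem dft_ofReal_isHermitian (N : ℕ) (v : ℝ → ℝ) : IsHermitian (dft N fun x => (v x : ℂ)) := by
  intro k
  simp only [dft, map_mul, map_inv₀, map_sum, Complex.conj_ofReal, conj_expo, map_natCast]

/-- A trigonometric polynomial is determined by its discrete Fourier coefficients. -/
theorem eq_sum_dft {N : ℕ} {φ : ℝ → ℂ} (h : φ ∈ trigSpace N) (x : ℝ) :
    φ x = ∑ k ∈ band N, dft N φ k * expo k x := by
  refine Submodule.span_induction ?_ ?_ ?_ ?_ h
  · rintro _ ⟨l, hl, rfl⟩
    have hl' : l ∈ band N := by simpa using hl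
    rw [Finset.sum_congr rfl fun k hk => by rw [dft_expo hk hl']]
    simp only [ite_mul, one_mul, zero_mul]
    rw [Finset.sum_ite_eq, if_pos hl']
  · simp [dft_zero]
  · intro φ ψ _ _ h1 h2
    simp only [dft_add, add_mul, Finset.sum_add_distrib, Pi.add_apply, h1, h2]
  · intro c φ _ h1
    simp only [dft_smul, Pi.smul_apply, smul_eq_mul, mul_assoc, ← Finset.mul_sum, h1]

theorem dft_proj (N : ℕ) (f : L2per) {k : ℤ} (hk : k ∈ band N) : dft N (proj N f) k = fc f k := by
  have h : proj N f = ∑ l ∈ band N, fc f l • expo l := by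
    ext x
    simp [proj]
  have hs : ∀ s : Finset ℤ, dft N (∑ l ∈ s, fc f l • expo l) k
      = ∑ l ∈ s, fc f l * dft N (expo l) k := by
    intro s
    induction s using Finset.cons_induction with
    | empty => simp [dft_zero]
    | cons a s ha ih => rw [Finset.sum_cons, Finset.sum_cons, dft_add, dft_smul, ih]
  rw [h, hs, Finset.sum_congr rfl fun l hl => by rw [dft_expo hk hl]]
  simp only [mul_ite, mul_one, mul_zero]
  rw [Finset.sum_ite_eq', if_pos hk]

/-! ### Semidiscrete solutions as curves in `L²` -/

theorem inBand_synth (N : ℕ) {c : ℤ → ℂ} (hc : IsHermitian c) : InBand N (synth N c) :=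
  inBand_of_fc fun k hk => by rw [fc_synth hc, if_neg hk]

theorem proj_synth (N : ℕ) {c : ℤ → ℂ} (hc : IsHermitian c) (x : ℝ) :
    proj N (synth N c) x = ∑ k ∈ band N, c k * expo k x :=
  Finset.sum_congr rfl fun k hk => by rw [fc_synth hc, if_pos hk]

theorem proj_projL2 (N : ℕ) (f : L2per) (x : ℝ) : proj N (projL2 N f) x = proj N f x :=
  proj_synth N (fc_isHermitian f) x

theorem trig_synth_dft {N : ℕ} {v : ℝ → ℝ} (h : (fun x => (v x : ℂ)) ∈ trigSpace N) :
    v = trig N (synth N (dft N fun x => (v x : ℂ))) := by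
  ext x
  rw [← Complex.ofReal_inj, ofReal_trig, proj_synth N (dft_ofReal_isHermitian N v)]
  exact eq_sum_dft h x

theorem hasDerivWithinAt_trig {Z : ℝ → L2per} {Z' : L2per} {s : Set ℝ} {t : ℝ}
    (h : HasDerivWithinAt Z Z' s t) (N : ℕ) (x : ℝ) :
    HasDerivWithinAt (fun r => trig N (Z r) x) (trig N Z' x) s t := by
  have h1 : HasDerivWithinAt (fun r => proj N (Z r) x) (proj N Z' x) s t :=
    HasDerivWithinAt.fun_sum fun k _ =>
      ((fcL k).hasFDerivAt.comp_hasDerivWithinAt t h).mul_const (expo k x)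
  exact Complex.reCLM.hasFDerivAt.comp_hasDerivWithinAt t h1

theorem hasDerivWithinAt_synth {c : ℝ → ℤ → ℂ} {c' : ℤ → ℂ} {s : Set ℝ} {t : ℝ}
    (h : ∀ k, HasDerivWithinAt (fun r => c r k) (c' k) s t) (N : ℕ) :
    HasDerivWithinAt (fun r => synth N (c r)) (synth N c') s t := by
  have h1 : HasDerivWithinAt
      (fun r => (∑ k ∈ band N, c r k • fourierLp (T := (1 : ℝ)) 2 k : Lp ℂ 2 haar))
      (∑ k ∈ band N, c' k • fourierLp (T := (1 : ℝ)) 2 k) s t :=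
    HasDerivWithinAt.fun_sum fun k _ => (h k).smul_const _
  exact (Complex.reCLM.compLpL 2 haar).hasFDerivAt.comp_hasDerivWithinAt t h1

/-- Discrete coefficients are finite combinations of point values. Differentiability in `t` at each
fixed `x` is thus enough for differentiability of the curve in `L²`. -/
theorem hasDerivWithinAt_synth_dft {T t : ℝ} {v : ℝ → ℝ → ℝ}
    (hv : ∀ x, DifferentiableOn ℝ (fun t => v t x) (Icc 0 T)) (ht : t ∈ Icc 0 T) (N : ℕ) :
    HasDerivWithinAt (fun r => synth N (dft N fun x => (v r x : ℂ)))
      (synth N (dft N fun x => (timeDeriv T v t x : ℂ))) (Icc 0 T) t := by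
  refine hasDerivWithinAt_synth (fun k => ?_) N
  have h1 : ∀ x, HasDerivWithinAt (fun r => (v r x : ℂ)) (timeDeriv T v t x : ℂ) (Icc 0 T) t :=
    fun x => ((hv x t ht).hasDerivWithinAt).ofReal_comp
  exact (HasDerivWithinAt.fun_sum fun j _ => (h1 _).mul_const _).const_mul _

theorem timeDeriv_eq_trig {T t : ℝ} (hT : 0 < T) (ht : t ∈ Icc 0 T) {N : ℕ} {v : ℝ → ℝ → ℝ}
    {Z : ℝ → L2per} {Z' : L2per} (hv : ∀ t ∈ Icc 0 T, v t = trig N (Z t))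
    (hZ : HasDerivWithinAt Z Z' (Icc 0 T) t) : timeDeriv T v t = trig N Z' := by
  ext x
  have h := (hasDerivWithinAt_trig hZ N x).congr (f₁ := fun s => v s x)
    (fun s hs => by rw [hv s hs]) (by rw [hv t ht])
  exact h.derivWithin (uniqueDiffOn_Icc hT t ht)

/-- This puts `uu_x` in the form `½(u²)_x`, so that both equations have the shape of `field`, the
second with `λ/2`. -/
theorem ip_mul_deriv {f : ℝ → ℝ} (hf : ContDiff ℝ ∞ f) (φ : ℝ → ℂ) :
    ip (fun x => f x * deriv f x) φ = 1 / 2 * ip (deriv fun x => f x * f x) φ := by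
  simp only [ip]
  rw [← intervalIntegral.integral_const_mul]
  congr 1
  ext x
  have hd := (hf.differentiable (by simp)).differentiableAt.hasDerivAt (x := x)
  rw [(hd.fun_mul hd).deriv]
  push_cast
  ring

variable {κ₁ κ₂ lam b d T : ℝ} {N : ℕ} {ζ₀ u₀ : L2per}

/-- A semidiscrete solution comes from a solution of the Galerkin equation in `L²`. -/
theorem IsSemidiscreteSolution.exists_curve {ζN uN : ℝ → ℝ → ℝ} (hb : 0 < b) (hd : 0 < d)
    (hT : 0 < T) (h : IsSemidiscreteSolution κ₁ κ₂ lam 0 b 0 d T N ζ₀ u₀ ζN uN) :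
    ∃ W : ℝ → L2per × L2per, W 0 = (projL2 N ζ₀, projL2 N u₀) ∧ ∀ t ∈ Icc 0 T,
      HasDerivWithinAt W (galerkinField κ₁ κ₂ lam b d N (W t)) (Icc 0 T) t ∧
        ζN t = trig N (W t).1 ∧ uN t = trig N (W t).2 := by
  have hζ := fun t ht => trig_synth_dft (h.mem_ζ t ht)
  have hu := fun t ht => trig_synth_dft (h.mem_u t ht)
  have hB : ∀ v : ℝ → ℝ, InBand N (synth N (dft N fun x => (v x : ℂ))) := fun v =>
    inBand_synth N (dft_ofReal_isHermitian N v)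
  refine ⟨fun t => (synth N (dft N fun x => (ζN t x : ℂ)), synth N (dft N fun x => (uN t x : ℂ))),
    ?_, fun t ht => ⟨?_, hζ t ht, hu t ht⟩⟩
  · refine Prod.ext (synth_congr fun k hk => ?_) (synth_congr fun k hk => ?_)
    · rw [← dft_proj N ζ₀ hk, funext h.init_ζ]
    · rw [← dft_proj N u₀ hk, funext h.init_u]
  have dζ := hasDerivWithinAt_synth_dft h.diff_ζ ht N
  have du := hasDerivWithinAt_synth_dft h.diff_u ht N
  have eζ := timeDeriv_eq_trig hT ht hζ dζ
  have eu := timeDeriv_eq_trig hT ht hu du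
  have key := dζ.prodMk du
  convert key using 1
  refine Prod.ext (fc_ext fun k => ?_) (fc_ext fun k => ?_)
  · simp only [galerkinField]
    rw [fc_field]
    split_ifs with hk
    · have h1 := h.eq_ζ t ht (expo k) (Submodule.subset_span ⟨k, by simpa using hk, rfl⟩)
      rw [eζ, hζ t ht, hu t ht, Complex.ofReal_zero, zero_mul, add_zero] at h1
      exact ((galerkin_expo_iff (hB _) (hB _) (hB _) (hB _) hb κ₁ lam k).1 h1).symm
    · exact ((hB _).fc_eq_zero hk).symm
  · simp only [galerkinField]
    rw [fc_field]
    split_ifs with hk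
    · have h1 := h.eq_u t ht (expo k) (Submodule.subset_span ⟨k, by simpa using hk, rfl⟩)
      rw [eu, hζ t ht, hu t ht, Complex.ofReal_zero, zero_mul, add_zero,
        ip_mul_deriv (contDiff_trig N _)] at h1
      refine ((galerkin_expo_iff (hB _) (hB _) (hB _) (hB _) hd κ₂ (lam / 2) k).1 ?_).symm
      push_cast
      linear_combination h1
    · exact ((hB _).fc_eq_zero hk).symm

/-- The difference `PZ - Z` has zero derivative and starts from zero. -/
theorem inBand_of_curve {Z Z' : ℝ → L2per} (h0 : InBand N (Z 0)) (hZ' : ∀ t, InBand N (Z' t))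
    (hZ : ∀ t ∈ Icc 0 T, HasDerivWithinAt Z (Z' t) (Icc 0 T) t) : ∀ t ∈ Icc 0 T, InBand N (Z t) := by
  have hd : ∀ t ∈ Icc 0 T, HasDerivWithinAt (fun t => projL2 N (Z t) - Z t) 0 (Icc 0 T) t := by
    intro t ht
    have h1 := ((projCLM N).hasFDerivAt.comp_hasDerivWithinAt t (hZ t ht)).sub (hZ t ht)
    have h2 : projL2 N (Z' t) = Z' t := hZ' t
    rw [projCLM_apply, h2, sub_self] at h1
    exact h1
  intro t ht
  have h := constant_of_has_deriv_right_zero (fun t ht => (hd t ht).continuousWithinAt)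
    (fun t ht => hasDerivWithinAt_Ici_of_Icc (hd t (Ico_subset_Icc_self ht)) ht) t ht
  rw [show projL2 N (Z 0) = Z 0 from h0, sub_self] at h
  exact sub_eq_zero.1 h

/-- A solution of the Galerkin equation in `L²` gives a semidiscrete solution. -/
theorem isSemidiscreteSolution_of_curve (hb : 0 < b) (hd : 0 < d) (hT : 0 < T)
    {W : ℝ → L2per × L2per} (hW0 : W 0 = (projL2 N ζ₀, projL2 N u₀))
    (hW : ∀ t ∈ Icc 0 T, HasDerivWithinAt W (galerkinField κ₁ κ₂ lam b d N (W t)) (Icc 0 T) t) :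
    (∀ t ∈ Icc 0 T, InBand N (W t).1 ∧ InBand N (W t).2) ∧
    IsSemidiscreteSolution κ₁ κ₂ lam 0 b 0 d T N ζ₀ u₀ (fun t => trig N (W t).1)
      (fun t => trig N (W t).2) := by
  have hW1 : ∀ t ∈ Icc 0 T, HasDerivWithinAt (fun t => (W t).1)
      (field N b κ₁ lam (W t).2 (W t).1 (W t).2) (Icc 0 T) t := fun t ht => (hW t ht).fst
  have hW2 : ∀ t ∈ Icc 0 T, HasDerivWithinAt (fun t => (W t).2)
      (field N d κ₂ (lam / 2) (W t).1 (W t).2 (W t).2) (Icc 0 T) t := fun t ht => (hW t ht).snd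
  have hB1 := inBand_of_curve (by rw [hW0]; exact inBand_projL2 N ζ₀)
    (fun t => inBand_field N b κ₁ lam (W t).2 (W t).1 (W t).2) hW1
  have hB2 := inBand_of_curve (by rw [hW0]; exact inBand_projL2 N u₀)
    (fun t => inBand_field N d κ₂ (lam / 2) (W t).1 (W t).2 (W t).2) hW2
  have hc : ∀ f : L2per, Continuous (trig N f) := fun f => (contDiff_trig N f).continuous
  have hcd : ∀ f : L2per, Continuous (deriv (trig N f)) := fun f =>
    (contDiff_trig N f).continuous_deriv (by simp)
  have hcd2 : ∀ f : L2per, Continuous (iteratedDeriv 2 (trig N f)) := fun f =>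
    (contDiff_infty.1 (contDiff_trig N f) 2).continuous_iteratedDeriv 2 le_rfl
  refine ⟨fun t ht => ⟨hB1 t ht, hB2 t ht⟩, ?_⟩
  refine ⟨fun t _ => trig_mem_trigSpace N _, fun t _ => trig_mem_trigSpace N _,
    fun x t ht => (hasDerivWithinAt_trig (hW1 t ht) N x).differentiableWithinAt,
    fun x t ht => (hasDerivWithinAt_trig (hW2 t ht) N x).differentiableWithinAt,
    fun x => by rw [ofReal_trig, hW0, proj_projL2], fun x => by rw [ofReal_trig, hW0, proj_projL2],
    fun t ht φ hφ => ?_, fun t ht φ hφ => ?_⟩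
  · rw [timeDeriv_eq_trig hT ht (fun _ _ => rfl) (hW1 t ht), Complex.ofReal_zero, zero_mul,
      add_zero]
    refine galerkin_of_expo (hc _) (hcd _)
      (((contDiff_trig N _).mul (contDiff_trig N _)).continuous_deriv (by simp)) (hcd2 _)
      (fun k hk => ?_) hφ
    rw [galerkin_expo_iff (inBand_field _ _ _ _ _ _ _) (hB2 t ht) (hB1 t ht) (hB2 t ht) hb,
      fc_field, if_pos hk]
  · rw [timeDeriv_eq_trig hT ht (fun _ _ => rfl) (hW2 t ht), Complex.ofReal_zero, zero_mul,
      add_zero]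
    refine galerkin_of_expo (hc _) (hcd _) ((hc _).mul (hcd _)) (hcd2 _) (fun k hk => ?_) hφ
    have h1 := (galerkin_expo_iff (inBand_field N d κ₂ (lam / 2) (W t).1 (W t).2 (W t).2)
      (hB1 t ht) (hB2 t ht) (hB2 t ht) hd κ₂ (lam / 2) k).2 (by rw [fc_field, if_pos hk])
    have h2 : ip (trig N (W t).2 * deriv (trig N (W t).2)) (expo k) = _ :=
      ip_mul_deriv (contDiff_trig N (W t).2) (expo k)
    rw [h2]
    push_cast at h1
    linear_combination h1

end BBM

/-! ### The error estimate -/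

theorem mainTheorem1 (κ₁ κ₂ lam b d T μ : ℝ) (hκ₁ : 0 < κ₁) (hκ₂ : 0 < κ₂)
    (hb : 0 < b) (hd : 0 < d) (hT : 0 < T) (hμ : 1 ≤ μ)
    (ζ₀ u₀ : BBM.HPer μ) (ζ u : ℝ → BBM.HPer μ)
    (hsol : BBM.IsSolution κ₁ κ₂ lam 0 b 0 d T ζ₀ u₀ ζ u) :
    ∃ C : ℝ, 0 < C ∧ ∃ N₀ : ℕ, 1 ≤ N₀ ∧ ∀ N : ℕ, N₀ ≤ N →
      ∃ ζN uN : ℝ → ℝ → ℝ,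
        BBM.IsSemidiscreteSolution κ₁ κ₂ lam 0 b 0 d T N ζ₀.toL2 u₀.toL2 ζN uN ∧
        (∀ ζN' uN' : ℝ → ℝ → ℝ,
          BBM.IsSemidiscreteSolution κ₁ κ₂ lam 0 b 0 d T N ζ₀.toL2 u₀.toL2 ζN' uN' →
            ∀ t ∈ Set.Icc 0 T, ζN' t = ζN t ∧ uN' t = uN t) ∧
        ∀ t ∈ Set.Icc 0 T,
          BBM.l2norm (fun x => ζN t x - (ζ t).fn x) + BBM.l2norm (fun x => uN t x - (u t).fn x)
            ≤ C * (N : ℝ) ^ (-μ) := by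
  have hμ0 : 0 ≤ μ := zero_le_one.trans hμ
  set I := Icc (0 : ℝ) T with hI
  have hU : UniqueDiffOn ℝ I := uniqueDiffOn_Icc hT
  -- bounds in `H^μ` for the exact solution and its time derivative
  obtain ⟨B₁, hB₁⟩ := isCompact_Icc.exists_bound_of_continuousOn hsol.contDiff_ζ.continuousOn
  obtain ⟨B₂, hB₂⟩ := isCompact_Icc.exists_bound_of_continuousOn hsol.contDiff_u.continuousOn
  obtain ⟨B₃, hB₃⟩ := isCompact_Icc.exists_bound_of_continuousOn
    (hsol.contDiff_ζ.continuousOn_derivWithin hU le_rfl)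
  obtain ⟨B₄, hB₄⟩ := isCompact_Icc.exists_bound_of_continuousOn
    (hsol.contDiff_u.continuousOn_derivWithin hU le_rfl)
  set B := max (max B₁ B₂) (max B₃ B₄) with hB
  have h0I : (0 : ℝ) ∈ I := ⟨le_rfl, hT.le⟩
  have hB0 : 0 ≤ B := (norm_nonneg _).trans ((hB₁ 0 h0I).trans (by simp [hB]))
  have bζ : ∀ t ∈ I, ‖ζ t‖ ≤ B := fun t ht => (hB₁ t ht).trans (by simp [hB])
  have bu : ∀ t ∈ I, ‖u t‖ ≤ B := fun t ht => (hB₂ t ht).trans (by simp [hB])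
  have bζ' : ∀ t ∈ I, ‖derivWithin ζ I t‖ ≤ B := fun t ht => (hB₃ t ht).trans (by simp [hB])
  have bu' : ∀ t ∈ I, ‖derivWithin u I t‖ ≤ B := fun t ht => (hB₄ t ht).trans (by simp [hB])
  -- Radius `B + 1` leaves room for an error of size `1` around the exact solution.
  obtain ⟨K, hK⟩ := BBM.galerkinField_lipschitzOn κ₁ κ₂ lam hb hd (B + 1)
  set G := gronwallBound B (K * 2 : NNReal) B T with hG
  have hG0 : 0 ≤ G := by
    have h := gronwallBound_mono hB0 hB0 (K * 2 : NNReal).2 hT.le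
    rw [gronwallBound_x0] at h
    exact hB0.trans h
  -- Each component has error at most `G * N^{-μ}`, and the added `1` makes the constant positive.
  -- The choice of `N₀` gives `G ≤ N`.
  refine ⟨2 * G + 1, by positivity, ⌈G⌉₊ + 1, by omega, fun N hN => ?_⟩
  have hN1 : 1 ≤ N := by omega
  have hN1' : (1 : ℝ) ≤ N := by exact_mod_cast hN1
  have hNpos : 0 ≤ (N : ℝ) ^ (-μ) := by positivity
  -- Here `μ ≥ 1` enters: `N^{-μ} ≤ N⁻¹`, so `G ≤ N` makes Grönwall's bound at most `1`.
  have hsmall : G * (N : ℝ) ^ (-μ) ≤ 1 := by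
    have h1 : G ≤ N := (Nat.le_ceil G).trans (by exact_mod_cast (by omega : ⌈G⌉₊ ≤ N))
    have h2 : (N : ℝ) ^ (-μ) ≤ (N : ℝ) ^ (-1 : ℝ) :=
      Real.rpow_le_rpow_of_exponent_le hN1' (by linarith)
    rw [Real.rpow_neg_one] at h2
    calc G * (N : ℝ) ^ (-μ) ≤ N * (N : ℝ)⁻¹ := by gcongr
      _ = 1 := mul_inv_cancel₀ (by positivity)
  have hV : ∀ t ∈ I, HasDerivWithinAt (fun t => ((ζ t).toL2, (u t).toL2))
      ((derivWithin ζ I t).toL2, (derivWithin u I t).toL2) I t := fun t ht =>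
    ((BBM.toL2CLM hμ0).hasFDerivAt.comp_hasDerivWithinAt t
      ((hsol.contDiff_ζ.differentiableOn one_ne_zero) t ht).hasDerivWithinAt).prodMk
    ((BBM.toL2CLM hμ0).hasFDerivAt.comp_hasDerivWithinAt t
      ((hsol.contDiff_u.differentiableOn one_ne_zero) t ht).hasDerivWithinAt)
  -- Consistency: at the exact solution the Galerkin field is the projection of the exact time
  -- derivative, so the residual is a pure projection error.
  have hF : ∀ t ∈ I, BBM.galerkinField κ₁ κ₂ lam b d N ((ζ t).toL2, (u t).toL2)
      = (BBM.projL2 N (derivWithin ζ I t).toL2, BBM.projL2 N (derivWithin u I t).toL2) := by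
    intro t ht
    refine Prod.ext (BBM.synth_congr fun k _ => ?_) (BBM.synth_congr fun k _ => ?_)
    · exact (BBM.fc_eq_symb_mul hb (hsol.eq_ζ t ht) k).symm
    · refine (BBM.fc_eq_symb_mul hd (fun φ h1 h2 => ?_) k).symm
      have h := hsol.eq_u t ht φ h1 h2
      simp only [pow_two] at h
      push_cast at h ⊢
      exact h
  obtain ⟨W, hW0, hW⟩ := BBM.exists_solution_near (R := B + 1) (by positivity) (hK N) hT.le hV
    (fun t ht => by
      gcongr
      exact norm_prod_le_iff.2 ⟨(BBM.norm_toL2_le hμ0 _).trans (bζ t ht),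
        (BBM.norm_toL2_le hμ0 _).trans (bu t ht)⟩)
    (δ := B * (N : ℝ) ^ (-μ)) (ε := B * (N : ℝ) ^ (-μ))
    (fun t ht => by
      rw [hF t ht]
      exact norm_prod_le_iff.2
        ⟨(BBM.norm_sub_projL2_le hμ0 _ hN1).trans (by gcongr; exact bζ' t ht),
          (BBM.norm_sub_projL2_le hμ0 _ hN1).trans (by gcongr; exact bu' t ht)⟩)
    (x₀ := (BBM.projL2 N ζ₀.toL2, BBM.projL2 N u₀.toL2))
    (by
      rw [← hsol.init_ζ, ← hsol.init_u]
      exact norm_prod_le_iff.2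
        ⟨(BBM.norm_sub_projL2_le hμ0 _ hN1).trans (by gcongr; exact bζ 0 h0I),
          (BBM.norm_sub_projL2_le hμ0 _ hN1).trans (by gcongr; exact bu 0 h0I)⟩)
    (by rwa [BBM.gronwallBound_mul])
  obtain ⟨hband, hsemi⟩ := BBM.isSemidiscreteSolution_of_curve hb hd hT hW0
    fun t ht => (hW t ht).1
  refine ⟨_, _, hsemi, fun ζN' uN' h' t ht => ?_, fun t ht => ?_⟩
  · obtain ⟨W', hW0', hW'⟩ := h'.exists_curve hb hd hT
    -- The competitor need not stay in the ball of radius `B + 1`; the Lipschitz property is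
    -- available on every ball.
    have hWW := BBM.solution_unique
      (fun R => (BBM.galerkinField_lipschitzOn κ₁ κ₂ lam hb hd R).imp fun _ h => h N)
      (fun t ht => (hW' t ht).1) (fun t ht => (hW t ht).1) (hW0'.trans hW0.symm) t ht
    rw [← hWW]
    exact (hW' t ht).2
  · have h := (hW t ht).2.2
    rw [BBM.gronwallBound_mul, norm_sub_rev] at h
    have h1 := (norm_fst_le _).trans h
    have h2 := (norm_snd_le _).trans h
    have e1 := (hband t ht).1.l2norm_sub (ζ t).toL2
    have e2 := (hband t ht).2.l2norm_sub (u t).toL2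
    calc _ = ‖(W t).1 - (ζ t).toL2‖ + ‖(W t).2 - (u t).toL2‖ := congrArg₂ (· + ·) e1 e2
      _ ≤ G * (N : ℝ) ^ (-μ) + G * (N : ℝ) ^ (-μ) := add_le_add h1 h2
      _ ≤ (2 * G + 1) * (N : ℝ) ^ (-μ) := by linarith

end
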